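/- Let $\Gamma$ be a finitely generated discrete group with a finite symmetric generating set $Q$ and word length $l$. Let $Z\subseteq \mathrm{Sub}(\Gamma)$ be a uniformly recurrent subgroup, i.e. a non-empty subset that is closed in the topology of pointwise convergence of characteristic functions, invariant under conjugation, and in which every conjugation orbit is dense. For $H\in Z$, the Schreier graph $S_\Gamma^Q(H)$ is the rooted labelled graph with vertex set $\Gamma/H$, root $H$, and for every vertex $x$ and $q\in Q$ an edge labelled $q$ from $x$ to $qx$; $d$ is its shortest-path metric and $B_R(x)$ is the ball of radius $R$ around $x$, as a labelled (induced) subgraph rooted at $x$. A root-label isomorphism of balls is a graph isomorphism preserving roots and labels. The graph $S_\Gamma^Q(H)$ has *local property A* if there are functions $\rho^n:\Gamma/H\to\ell^2(\Gamma/H)$, $x\mapsto\rho^n_x$ ($n\ge 1$), such that * $\|\rho^n_x\|_2=1$ for all $x$, and $\|\rho^n_x-\rho^n_y\|_2\le 1/n$ whenever $d(x,y)\le n$; * for each $n$ there is $R_n>0$ such that $\rho^n_x$ is supported in $B_{R_n}(x)$ for all $x$, and $\rho^n_y\circ\theta=\rho^n_x$ on $B_{R_n}(x)$ for every root-label isomorphism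 $\theta:B_{R_n}(x)\to B_{R_n}(y)$. The groupoid $\mathcal G$ associated with $Z$ is constructed from any $H_0\in Z$ as follows. Let $S=S_\Gamma^Q(H_0)$, let $E_n$ be the set of classes $[p]_n$ of vertices $p$ of $S$ modulo root-label isomorphism of the $n$-balls around them, and let $\mathcal G^0=\varprojlim E_n$. For $x=([x_n]_n)_n\in\mathcal G^0$ and $\gamma\in\Gamma$ put $\gamma x=([\gamma x_{n+l(\gamma)}]_n)_n$. The arrows of $\mathcal G$ are the pairs $(x,\gamma)\in\mathcal G^0\times\Gamma$, where $(x,\gamma)$ and $(x,\gamma')$ are identified if $\gamma x_m=\gamma' x_m$ for $m=\max\{l(\gamma),l(\gamma')\}$; the range of $(x,\gamma)$ is $x$, its source is $\gamma x$, and $$(x,\gamma)(\gamma x,\gamma')=(x,\gamma'\gamma),\qquad (x,\gamma)^{-1}=(\gamma x,\gamma^{-1}).$$ The topology of $\mathcal G$ is the subspace topology of $\varprojlim F_n$, where $F_n=\bigsqcup_{[x_n]\in E_n}B_n(x_n)\sqcup\{\infty_n\}$ is discrete and the $F_n$-component of $(x,\gamma)$ is the vertex $\gamma' x_n$ of $B_n(x_n)$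 if $(x,\gamma)=(x,\gamma')$ for some $\gamma'$ with $l(\gamma')\le n$, and $\infty_n$ otherwise. The étale groupoid $\mathcal G$ is *topologically amenable* if there is a net $(f_i)$ in $C_c(\mathcal G)$ such that the functions $u\mapsto\sum_{h\in\mathcal G^u}|f_i(h)|^2$ on $\mathcal G^0$, where $\mathcal G^u$ is the set of arrows with range $u$, are bounded uniformly in $i$ and $u$, and $$(f_i*f_i^*)(g)=\sum_{h\in\mathcal G^{s(g)}}f_i(gh)\,\overline{f_i(h)}$$ converges to $1$ uniformly on compact subsets of $\mathcal G$. **Theorem 5.3.** For every $H\in Z$ (and every choice of $H_0\in Z$ in the construction of $\mathcal G$), the Schreier graph $S_\Gamma^Q(H)$ has local property A if and only if $\mathcal G$ is topologically amenable. -/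

import Mathlib

open CategoryTheory

universe u

/-! ### The space of subgroups and uniformly recurrent subgroups -/

/-- The topology on `Sub(Γ)` of pointwise convergence of characteristic functions. -/
noncomputable instance subgroupTopology {Γ : Type u} [Group Γ] :
    TopologicalSpace (Subgroup Γ) :=
  open scoped Classical in
  TopologicalSpace.induced (fun (H : Subgroup Γ) (γ : Γ) => decide (γ ∈ H)) inferInstance

/-- The conjugate `γ.H = γ H γ⁻¹`. -/
def conjSubgroup {Γ : Type u} [Group Γ] (γ : Γ) (H : Subgroup Γ) : Subgroup Γ :=
  H.map (MulAut.conj γ).toMonoidHom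

/-- `Z` is a uniformly recurrent subgroup: a nonempty closed conjugation-invariant set of subgroups
in which every orbit is dense. -/
structure IsURS {Γ : Type u} [Group Γ] (Z : Set (Subgroup Γ)) : Prop where
  nonempty : Z.Nonempty
  isClosed : IsClosed Z
  invariant : ∀ H ∈ Z, ∀ γ : Γ, conjSubgroup γ H ∈ Z
  minimal : ∀ H ∈ Z, Z ⊆ closure (Set.range fun γ : Γ => conjSubgroup γ H)

/-- A finite symmetric system of generators of `Γ`. -/
structure GeneratingSystem (Γ : Type u) [Group Γ] where
  carrier : Finset Γ
  inv_mem : ∀ q ∈ carrier, q⁻¹ ∈ carrier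
  closure_eq_top : Subgroup.closure (carrier : Set Γ) = ⊤

/-! ### Schreier graphs

The definitions are made for a set `X` with a left action of `Γ`; the Schreier graph of `H` is the
case `X = Γ ⧸ H`. For every vertex `u` and every `q` in the generating system there is one edge
labelled `q`, from `u` to `q • u`. -/

section Schreier

variable {Γ : Type u} [Group Γ] (Q : GeneratingSystem Γ)

/-- The unlabelled graph underlying the Schreier graph, used for its shortest-path metric. -/
def schreierGraph (X : Type u) [MulAction Γ X] : SimpleGraph X :=
  SimpleGraph.fromRel fun u v => ∃ q ∈ Q.carrier, q • u = v

variable {X : Type u} [MulAction Γ X]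

/-- The ball of radius `R` around `x` in the shortest-path metric. -/
def schreierBall (R : ℕ) (x : X) : Set X :=
  {y | (schreierGraph Q X).edist x y ≤ R}

/-- A root-label isomorphism between the balls of radius `R` around `x` and `y`, as labelled induced
subgraphs: a bijection preserving the root, with an edge labelled `q` from `u` to `v` if
and only if there is one from the image of `u` to the image of `v`. -/
structure RootLabelIso (R : ℕ) (x y : X) where
  toEquiv : schreierBall Q R x ≃ schreierBall Q R y
  map_root : ∀ u : schreierBall Q R x, (u : X) = x → (toEquiv u : X) = y
  map_label : ∀ u v : schreierBall Q R x, ∀ q ∈ Q.carrier,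
    q • (u : X) = v ↔ q • (toEquiv u : X) = toEquiv v

/-- The word length of `γ`. -/
noncomputable def wordLength (γ : Γ) : ℕ :=
  sInf {n | ∃ w : List Γ, (∀ q ∈ w, q ∈ Q.carrier) ∧ w.prod = γ ∧ w.length = n}

theorem exists_word (γ : Γ) :
    ∃ w : List Γ, (∀ q ∈ w, q ∈ Q.carrier) ∧ w.prod = γ ∧ w.length = wordLength Q γ := by
  have hne : {n | ∃ w : List Γ, (∀ q ∈ w, q ∈ Q.carrier) ∧ w.prod = γ ∧ w.length = n}.Nonempty := by
    have hγ : γ ∈ (Subgroup.closure (Q.carrier : Set Γ)).toSubmonoid := by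
      rw [Q.closure_eq_top]; trivial
    rw [Subgroup.closure_toSubmonoid] at hγ
    obtain ⟨w, hw, hp⟩ := Submonoid.exists_list_of_mem_closure hγ
    refine ⟨w.length, w, ?_, hp, rfl⟩
    intro q hq
    rcases hw q hq with h | h
    · exact h
    · simpa using Q.inv_mem _ h
  exact Nat.sInf_mem hne

theorem wordLength_le {w : List Γ} (hw : ∀ q ∈ w, q ∈ Q.carrier) :
    wordLength Q w.prod ≤ w.length :=
  Nat.sInf_le ⟨w, hw, rfl, rfl⟩

theorem wordLength_one : wordLength Q 1 = 0 := by
  have h := wordLength_le Q (w := []) (by simp)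
  simpa using h

theorem wordLength_mul (γ δ : Γ) : wordLength Q (γ * δ) ≤ wordLength Q γ + wordLength Q δ := by
  obtain ⟨w, hw, rfl, hl⟩ := exists_word Q γ
  obtain ⟨v, hv, rfl, hk⟩ := exists_word Q δ
  rw [← hl, ← hk, ← List.prod_append, ← List.length_append]
  apply wordLength_le
  intro q hq
  rcases List.mem_append.1 hq with h | h
  exacts [hw q h, hv q h]

variable {Q}

theorem self_mem_schreierBall (R : ℕ) (x : X) : x ∈ schreierBall Q R x := by
  simp [schreierBall]

theorem smul_mem_schreierBall_succ {R : ℕ} {x u : X} (hu : u ∈ schreierBall Q R x) {q : Γ}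
    (hq : q ∈ Q.carrier) : q • u ∈ schreierBall Q (R + 1) x := by
  have h1 : (schreierGraph Q X).edist u (q • u) ≤ 1 := by
    by_cases h : u = q • u
    · rw [← h]; simp
    · have hadj : (schreierGraph Q X).Adj u (q • u) := by
        rw [schreierGraph, SimpleGraph.fromRel_adj]
        exact ⟨h, Or.inl ⟨q, hq, rfl⟩⟩
      simpa using hadj.toWalk.edist_le
  have h2 := SimpleGraph.edist_triangle (G := schreierGraph Q X) (u := x) (v := u) (w := q • u)
  have hu' : (schreierGraph Q X).edist x u ≤ R := hu
  change (schreierGraph Q X).edist x (q • u) ≤ ((R + 1 : ℕ) : ℕ∞)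
  push_cast
  exact h2.trans (add_le_add hu' h1)

theorem word_smul_mem_schreierBall (x : X) {w : List Γ} (hw : ∀ q ∈ w, q ∈ Q.carrier) :
    w.prod • x ∈ schreierBall Q w.length x := by
  induction w with
  | nil => simpa using self_mem_schreierBall 0 x
  | cons q w ih =>
    rw [List.prod_cons, mul_smul, List.length_cons]
    exact smul_mem_schreierBall_succ (ih fun p hp => hw p (by simp [hp])) (hw q (by simp))

theorem schreierBall_mono {R R' : ℕ} (h : R ≤ R') (x : X) :
    schreierBall Q R x ⊆ schreierBall Q R' x := by
  intro y hy
  exact le_trans (show (schreierGraph Q X).edist x y ≤ R from hy) (by exact_mod_cast h)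

theorem smul_mem_schreierBall {R : ℕ} {γ : Γ} (h : wordLength Q γ ≤ R) (x : X) :
    γ • x ∈ schreierBall Q R x := by
  obtain ⟨w, hw, rfl, hl⟩ := exists_word Q γ
  exact schreierBall_mono (hl.trans_le h) x (word_smul_mem_schreierBall x hw)

theorem exists_smul_of_walk {x y : X} (p : (schreierGraph Q X).Walk x y) :
    ∃ γ : Γ, wordLength Q γ ≤ p.length ∧ γ • x = y := by
  induction p with
  | nil => exact ⟨1, by simp [wordLength_one], one_smul _ _⟩
  | @cons a b c h p ih =>
    obtain ⟨γ, hγ, hc⟩ := ih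
    obtain ⟨q, hq, hb⟩ : ∃ q ∈ Q.carrier, q • a = b := by
      rw [schreierGraph, SimpleGraph.fromRel_adj] at h
      rcases h.2 with ⟨q, hq, hb⟩ | ⟨q, hq, hb⟩
      · exact ⟨q, hq, hb⟩
      · exact ⟨q⁻¹, Q.inv_mem q hq, by rw [← hb, inv_smul_smul]⟩
    refine ⟨γ * q, ?_, by rw [mul_smul, hb, hc]⟩
    have h1 : wordLength Q q ≤ 1 := by
      simpa using wordLength_le Q (w := [q]) (by simpa using hq)
    rw [SimpleGraph.Walk.length_cons]
    exact (wordLength_mul Q γ q).trans (add_le_add hγ h1)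

theorem mem_schreierBall_iff {R : ℕ} {x y : X} :
    y ∈ schreierBall Q R x ↔ ∃ γ : Γ, wordLength Q γ ≤ R ∧ γ • x = y := by
  constructor
  · intro h
    have h' : (schreierGraph Q X).edist x y ≤ R := h
    have hne : (schreierGraph Q X).edist x y ≠ ⊤ :=
      ne_top_of_le_ne_top (ENat.natCast_ne_top R) h'
    obtain ⟨p, hp⟩ := SimpleGraph.exists_walk_of_edist_ne_top hne
    obtain ⟨γ, hγ, hy⟩ := exists_smul_of_walk p
    refine ⟨γ, hγ.trans ?_, hy⟩
    rw [← hp] at h'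
    exact_mod_cast h'
  · rintro ⟨γ, hγ, rfl⟩
    exact smul_mem_schreierBall hγ x

namespace RootLabelIso

/-- The identity root-label isomorphism. -/
def refl (R : ℕ) (x : X) : RootLabelIso Q R x x where
  toEquiv := Equiv.refl _
  map_root _ h := h
  map_label _ _ _ _ := Iff.rfl

/-- The inverse root-label isomorphism. -/
def symm {R : ℕ} {x y : X} (θ : RootLabelIso Q R x y) : RootLabelIso Q R y x where
  toEquiv := θ.toEquiv.symm
  map_root u hu := by
    have h := θ.map_root ⟨x, self_mem_schreierBall R x⟩ rfl
    have h2 : θ.toEquiv ⟨x, self_mem_schreierBall R x⟩ = u := Subtype.ext (h.trans hu.symm)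
    rw [← h2, Equiv.symm_apply_apply]
  map_label u v q hq := by
    rw [θ.map_label (θ.toEquiv.symm u) (θ.toEquiv.symm v) q hq]
    simp

/-- The composition of root-label isomorphisms. -/
def trans {R : ℕ} {x y z : X} (θ : RootLabelIso Q R x y) (η : RootLabelIso Q R y z) :
    RootLabelIso Q R x z where
  toEquiv := θ.toEquiv.trans η.toEquiv
  map_root u hu := η.map_root _ (θ.map_root u hu)
  map_label u v q hq := (θ.map_label u v q hq).trans (η.map_label _ _ q hq)

theorem apply_word {R : ℕ} {x y : X} (θ : RootLabelIso Q R x y) {w : List Γ}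
    (hw : ∀ q ∈ w, q ∈ Q.carrier) (hl : w.length ≤ R) (h : w.prod • x ∈ schreierBall Q R x) :
    (θ.toEquiv ⟨w.prod • x, h⟩ : X) = w.prod • y := by
  induction w with
  | nil => simpa using θ.map_root ⟨_, h⟩ (by simp)
  | cons q w ih =>
    have hw' : ∀ p ∈ w, p ∈ Q.carrier := fun p hp => hw p (by simp [hp])
    have hl' : w.length ≤ R := by
      rw [List.length_cons] at hl; omega
    have hm : w.prod • x ∈ schreierBall Q R x :=
      schreierBall_mono hl' x (word_smul_mem_schreierBall x hw')
    have := (θ.map_label ⟨_, hm⟩ ⟨_, h⟩ q (hw q (by simp))).1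
      (by simp only [List.prod_cons, mul_smul])
    rw [← this, ih hw' hl' hm, List.prod_cons, mul_smul]

theorem apply_smul {R : ℕ} {x y : X} (θ : RootLabelIso Q R x y) {γ : Γ}
    (hγ : wordLength Q γ ≤ R) (h : γ • x ∈ schreierBall Q R x) :
    (θ.toEquiv ⟨γ • x, h⟩ : X) = γ • y := by
  obtain ⟨w, hw, rfl, hl⟩ := exists_word Q γ
  exact θ.apply_word hw (hl.trans_le hγ) h

theorem smul_eq {R : ℕ} {x y : X} (θ : RootLabelIso Q R x y) {γ γ' : Γ}
    (hγ : wordLength Q γ ≤ R) (hγ' : wordLength Q γ' ≤ R) (h : γ • x = γ' • x) :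
    γ • y = γ' • y := by
  rw [← θ.apply_smul hγ (smul_mem_schreierBall hγ x),
    ← θ.apply_smul hγ' (smul_mem_schreierBall hγ' x)]
  simp only [h]

theorem schreierBall_smul_subset {R n : ℕ} {γ : Γ} (hγ : n + wordLength Q γ ≤ R) (x : X) :
    schreierBall Q n (γ • x) ⊆ schreierBall Q R x := by
  intro z hz
  obtain ⟨δ, hδ, rfl⟩ := mem_schreierBall_iff.1 hz
  rw [← mul_smul]
  exact smul_mem_schreierBall ((wordLength_mul Q δ γ).trans (by omega)) x

theorem apply_mem {R n : ℕ} {x y : X} (θ : RootLabelIso Q R x y) {γ : Γ}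
    (hγ : n + wordLength Q γ ≤ R) {z : X} (hz : z ∈ schreierBall Q n (γ • x)) :
    (θ.toEquiv ⟨z, schreierBall_smul_subset hγ x hz⟩ : X) ∈ schreierBall Q n (γ • y) := by
  obtain ⟨δ, hδ, rfl⟩ := mem_schreierBall_iff.1 hz
  have h := θ.apply_smul (γ := δ * γ) ((wordLength_mul Q δ γ).trans (by omega))
    (by rw [mul_smul]; exact schreierBall_smul_subset hγ x hz)
  simp only [mul_smul] at h
  rw [h]
  exact smul_mem_schreierBall hδ _

/-- The restriction of a root-label isomorphism to smaller balls around corresponding vertices. -/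
def restrict {R n : ℕ} {x y : X} (θ : RootLabelIso Q R x y) (γ : Γ)
    (hγ : n + wordLength Q γ ≤ R) : RootLabelIso Q n (γ • x) (γ • y) where
  toEquiv :=
    { toFun := fun z => ⟨_, θ.apply_mem hγ z.2⟩
      invFun := fun z => ⟨_, θ.symm.apply_mem hγ z.2⟩
      left_inv := fun z => by
        apply Subtype.ext
        simp [symm]
      right_inv := fun z => by
        apply Subtype.ext
        simp [symm] }
  map_root u hu := by
    have hm : γ • x ∈ schreierBall Q R x := smul_mem_schreierBall (by omega) x
    have h := θ.apply_smul (γ := γ) (by omega) hm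
    simp only [Equiv.coe_fn_mk]
    rw [← h]
    congr 2
    exact Subtype.ext hu
  map_label u v q hq := θ.map_label ⟨u, _⟩ ⟨v, _⟩ q hq

end RootLabelIso

end Schreier

/-! ### Local property A -/

/-- Local property A of the Schreier graph of `H`: there are local functions
`ρⁿ : Γ/H → ℓ²(Γ/H)` of norm one with `‖ρⁿ_x - ρⁿ_y‖ ≤ 1/n` whenever `d(x, y) ≤ n`. -/
def LocalPropertyA {Γ : Type u} [Group Γ] (Q : GeneratingSystem Γ) (H : Subgroup Γ) : Prop :=
  ∃ ρ : ℕ → Γ ⧸ H → lp (fun _ : Γ ⧸ H => ℂ) 2,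
    (∀ n : ℕ, 1 ≤ n → ∃ R : ℕ, 0 < R ∧
      (∀ x y : Γ ⧸ H, y ∉ schreierBall Q R x → ρ n x y = 0) ∧
      ∀ (x y : Γ ⧸ H) (θ : RootLabelIso Q R x y) (z : schreierBall Q R x),
        ρ n y (θ.toEquiv z) = ρ n x z) ∧
    (∀ n : ℕ, 1 ≤ n → ∀ x, ‖ρ n x‖ = 1) ∧
    ∀ n : ℕ, 1 ≤ n → ∀ x y : Γ ⧸ H, (schreierGraph Q (Γ ⧸ H)).edist x y ≤ n →
      ‖ρ n x - ρ n y‖ ≤ 1 / (n : ℝ)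

/-! ### The unit space -/

section UnitSpace

variable {Γ : Type u} [Group Γ] (Q : GeneratingSystem Γ) (X : Type u) [MulAction Γ X]

/-- `p ∼ₙ q` if the `n`-balls around `p` and `q` are root-label isomorphic. -/
def ballSetoid (n : ℕ) : Setoid X where
  r p q := Nonempty (RootLabelIso Q n p q)
  iseqv :=
    { refl := fun p => ⟨RootLabelIso.refl n p⟩
      symm := fun ⟨θ⟩ => ⟨θ.symm⟩
      trans := fun ⟨θ⟩ ⟨η⟩ => ⟨θ.trans η⟩ }

/-- The set `Eₙ` of root-label isomorphism classes of `n`-balls. -/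
def BallClass (n : ℕ) : Type u := Quotient (ballSetoid Q X n)

variable {X}

/-- The class `[p]ₙ`. -/
def ballClass (n : ℕ) (p : X) : BallClass Q X n := Quotient.mk (ballSetoid Q X n) p

theorem ballClass_eq_iff {n : ℕ} {p q : X} :
    ballClass Q n p = ballClass Q n q ↔ Nonempty (RootLabelIso Q n p q) :=
  Quotient.eq (r := ballSetoid Q X n)

theorem exists_rep {n : ℕ} (a : BallClass Q X n) : ∃ p, a = ballClass Q n p :=
  ⟨Quotient.out a, (Quotient.out_eq a).symm⟩

/-- The map `E_m → E_n`, `[p]_m ↦ [γ p]_n` for `m ≥ n + l(γ)`. -/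
def BallClass.move {m n : ℕ} (γ : Γ) (h : n + wordLength Q γ ≤ m) :
    BallClass Q X m → BallClass Q X n :=
  Quotient.map' (s₁ := ballSetoid Q X m) (s₂ := ballSetoid Q X n) (fun p => γ • p)
    fun _ _ ⟨θ⟩ => ⟨θ.restrict γ h⟩

/-- The connecting map `E_{n+1} → E_n`, `[p]_{n+1} ↦ [p]_n`. -/
def BallClass.connect (n : ℕ) : BallClass Q X (n + 1) → BallClass Q X n :=
  Quotient.map' (s₁ := ballSetoid Q X (n + 1)) (s₂ := ballSetoid Q X n) (fun p => p)
    fun p q ⟨θ⟩ => ⟨by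
      have η := θ.restrict (n := n) 1 (by rw [wordLength_one]; omega)
      rwa [one_smul, one_smul] at η⟩

variable (X)

/-- The projective limit of the sets `Eₙ`. -/
@[ext]
structure UnitSpace : Type u where
  coord : ∀ n, BallClass Q X n
  connect_coord : ∀ n, BallClass.connect Q n (coord (n + 1)) = coord n

variable {Q X}

/-- `p` represents the `n`-coordinate of `x`. -/
def UnitSpace.Rep (x : UnitSpace Q X) (n : ℕ) (p : X) : Prop := x.coord n = ballClass Q n p

namespace UnitSpace

theorem exists_rep (x : UnitSpace Q X) (n : ℕ) : ∃ p, x.Rep n p := _root_.exists_rep Q (x.coord n)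

theorem Rep.of_le {x : UnitSpace Q X} {m n : ℕ} {p : X} (h : x.Rep m p) (hnm : n ≤ m) :
    x.Rep n p := by
  induction m, hnm using Nat.le_induction with
  | base => exact h
  | succ m _ ih =>
    apply ih
    have := x.connect_coord m
    rw [show x.coord (m + 1) = ballClass Q (m + 1) p from h] at this
    exact this.symm

theorem Rep.iso {x : UnitSpace Q X} {n : ℕ} {p q : X} (hp : x.Rep n p) (hq : x.Rep n q) :
    Nonempty (RootLabelIso Q n p q) :=
  (ballClass_eq_iff Q).1 (hp.symm.trans hq)

theorem ext_of {x y : UnitSpace Q X} (h : ∀ n, ∃ p, x.Rep n p ∧ y.Rep n p) : x = y := by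
  apply UnitSpace.ext
  funext n
  obtain ⟨p, hx, hy⟩ := h n
  exact hx.trans hy.symm

/-- `γ x = ([γ x_{l(γ)}]₀, [γ x_{l(γ)+1}]₁, …)`. -/
noncomputable instance : SMul Γ (UnitSpace Q X) where
  smul γ x := ⟨fun n => BallClass.move Q γ le_rfl (x.coord (n + wordLength Q γ)), fun n => by
    obtain ⟨p, hp⟩ := x.exists_rep (n + 1 + wordLength Q γ)
    have hp' := hp.of_le (n := n + wordLength Q γ) (by omega)
    rw [show x.coord (n + 1 + wordLength Q γ) = _ from hp,
      show x.coord (n + wordLength Q γ) = _ from hp']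
    rfl⟩

theorem Rep.smul {x : UnitSpace Q X} {m n : ℕ} {p : X} (h : x.Rep m p) (γ : Γ)
    (hnm : n + wordLength Q γ ≤ m) : (γ • x).Rep n (γ • p) := by
  have h' := h.of_le hnm
  change BallClass.move Q γ le_rfl (x.coord (n + wordLength Q γ)) = _
  rw [show x.coord (n + wordLength Q γ) = _ from h']
  rfl

noncomputable instance : MulAction Γ (UnitSpace Q X) where
  one_smul x := ext_of fun n => by
    obtain ⟨p, hp⟩ := x.exists_rep n
    refine ⟨p, ?_, hp⟩
    simpa using hp.smul (n := n) 1 (by rw [wordLength_one]; omega)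
  mul_smul γ δ x := ext_of fun n => by
    obtain ⟨p, hp⟩ := x.exists_rep (n + wordLength Q γ + wordLength Q δ)
    refine ⟨(γ * δ) • p, ?_, ?_⟩
    · refine hp.smul (γ * δ) ?_
      have := wordLength_mul Q γ δ
      omega
    · rw [mul_smul]
      exact (hp.smul δ (n := n + wordLength Q γ) le_rfl).smul γ le_rfl

/-- The pairs `(x, γ)` and `(x, γ')` denote the same arrow if `γ x_m = γ' x_m`, where `m` is the
maximum of the lengths of `γ` and `γ'` (the choice of the representative `x_m` is immaterial). -/
def SameArrow (x : UnitSpace Q X) (γ γ' : Γ) : Prop :=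
  ∀ p : X, x.Rep (max (wordLength Q γ) (wordLength Q γ')) p → γ • p = γ' • p

theorem SameArrow.eq {x : UnitSpace Q X} {γ γ' : Γ} (h : x.SameArrow γ γ') {m : ℕ}
    (hγ : wordLength Q γ ≤ m) (hγ' : wordLength Q γ' ≤ m) {p : X} (hp : x.Rep m p) :
    γ • p = γ' • p :=
  h p (hp.of_le (max_le hγ hγ'))

theorem SameArrow.of_eq {x : UnitSpace Q X} {γ γ' : Γ} {m : ℕ}
    (hγ : wordLength Q γ ≤ m) (hγ' : wordLength Q γ' ≤ m) {p : X} (hp : x.Rep m p)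
    (h : γ • p = γ' • p) : x.SameArrow γ γ' := by
  intro q hq
  obtain ⟨θ⟩ := (hp.of_le (max_le hγ hγ')).iso hq
  exact θ.smul_eq (le_max_left _ _) (le_max_right _ _) h

end UnitSpace

end UnitSpace

/-! ### The groupoid -/

section Groupoid

variable {Γ : Type u} [Group Γ] {Q : GeneratingSystem Γ} {X : Type u} [MulAction Γ X]

/-- Group elements `γ` with `γ x = y`, up to denoting the same arrow `(x, γ)`. -/
def arrowSetoid (x y : UnitSpace Q X) : Setoid {γ : Γ // γ • x = y} where
  r γ γ' := x.SameArrow γ γ'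
  iseqv :=
    { refl := fun _ _ _ => rfl
      symm := fun {γ γ'} h p hp => (h.eq (le_max_right _ _) (le_max_left _ _) hp).symm
      trans := fun {a b c} h k => by
        obtain ⟨p, hp⟩ := x.exists_rep
          (wordLength Q a.1 + wordLength Q b.1 + wordLength Q c.1)
        exact UnitSpace.SameArrow.of_eq (by omega) (by omega) hp
          ((h.eq (by omega) (by omega) hp).trans (k.eq (by omega) (by omega) hp)) }

/-- The groupoid of the Schreier graph, with unit space `lim Eₙ`. The morphisms `x ⟶ y` are the
arrows `(x, γ)` with range `x` and source `γ x = y`, the composition `g ≫ h` is the product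
`g h`, that is, `(x, γ)(γ x, γ') = (x, γ' γ)`, and the inverse of `(x, γ)` is `(γ x, γ⁻¹)`. -/
noncomputable instance schreierGroupoid : Groupoid.{u} (UnitSpace Q X) where
  Hom x y := Quotient (arrowSetoid x y)
  id x := Quotient.mk _ ⟨1, one_smul _ _⟩
  comp {x y z} := Quotient.map₂
    (fun γ γ' => ⟨γ'.1 * γ.1, by rw [mul_smul, γ.2, γ'.2]⟩) (by
      intro a b hab c d hcd
      have hab' : x.SameArrow a.1 b.1 := hab
      have hcd' : y.SameArrow c.1 d.1 := hcd
      obtain ⟨p, hp⟩ := x.exists_rep (wordLength Q c.1 + wordLength Q d.1 +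
        (wordLength Q a.1 + wordLength Q b.1))
      have h1 : a.1 • p = b.1 • p := hab'.eq (by omega) (by omega) hp
      have hy : y.Rep (wordLength Q c.1 + wordLength Q d.1) (a.1 • p) := by
        have := hp.smul a.1 (n := wordLength Q c.1 + wordLength Q d.1) (by omega)
        rwa [a.2] at this
      have h2 := hcd'.eq (by omega) (by omega) hy
      have l1 := wordLength_mul Q c.1 a.1
      have l2 := wordLength_mul Q d.1 b.1
      refine UnitSpace.SameArrow.of_eq (l1.trans (by omega)) (l2.trans (by omega)) hp ?_
      rw [mul_smul, mul_smul, h2, h1])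
  inv {x y} := Quotient.map
    (fun γ => ⟨γ.1⁻¹, inv_smul_eq_iff.2 γ.2.symm⟩) (by
      intro a b hab
      have hab' : x.SameArrow a.1 b.1 := hab
      obtain ⟨p, hp⟩ := x.exists_rep (wordLength Q a.1⁻¹ + wordLength Q b.1⁻¹ +
        (wordLength Q a.1 + wordLength Q b.1))
      have h1 : a.1 • p = b.1 • p := hab'.eq (by omega) (by omega) hp
      have hy : y.Rep (wordLength Q a.1⁻¹ + wordLength Q b.1⁻¹) (a.1 • p) := by
        have := hp.smul a.1 (n := wordLength Q a.1⁻¹ + wordLength Q b.1⁻¹) (by omega)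
        rwa [a.2] at this
      refine UnitSpace.SameArrow.of_eq (Nat.le_add_right _ _) (Nat.le_add_left _ _) hy ?_
      rw [inv_smul_smul, h1, inv_smul_smul])
  id_comp {x y} f := by
    induction f using Quotient.inductionOn with
    | h a => exact congrArg (Quotient.mk _) (Subtype.ext (mul_one _))
  comp_id {x y} f := by
    induction f using Quotient.inductionOn with
    | h a => exact congrArg (Quotient.mk _) (Subtype.ext (one_mul _))
  assoc {w x y z} f g h := by
    induction f using Quotient.inductionOn with
    | h a =>
      induction g using Quotient.inductionOn with
      | h b =>
        induction h using Quotient.inductionOn with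
        | h c => exact congrArg (Quotient.mk _) (Subtype.ext (mul_assoc _ _ _).symm)
  inv_comp {x y} f := by
    induction f using Quotient.inductionOn with
    | h a => exact congrArg (Quotient.mk _) (Subtype.ext (mul_inv_cancel _))
  comp_inv {x y} f := by
    induction f using Quotient.inductionOn with
    | h a => exact congrArg (Quotient.mk _) (Subtype.ext (inv_mul_cancel _))

end Groupoid

/-- The set of all arrows of a groupoid; the morphism `hom : rng ⟶ src` is regarded as an arrow
with range `rng` and source `src`, so that `g ≫ h` is the product `g h`. -/
structure ArrowSpace (C : Type u) [Groupoid.{u} C] where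
  rng : C
  src : C
  hom : rng ⟶ src

section Topology

variable {Γ : Type u} [Group Γ] {Q : GeneratingSystem Γ} {X : Type u} [MulAction Γ X]

/-- The arrow `(x, γ)`. -/
noncomputable def arrowMk (x : UnitSpace Q X) (γ : Γ) : ArrowSpace (UnitSpace Q X) where
  rng := x
  src := γ • x
  hom := Quotient.mk (arrowSetoid x (γ • x)) ⟨γ, rfl⟩

theorem arrowMk_eq_iff {x : UnitSpace Q X} {γ γ' : Γ} :
    arrowMk x γ = arrowMk x γ' ↔ x.SameArrow γ γ' := by
  constructor
  · intro h
    have key : ∀ {y : UnitSpace Q X} (hy : γ' • x = y) (a : x ⟶ y),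
        (⟨x, γ • x, Quotient.mk (arrowSetoid x (γ • x)) ⟨γ, rfl⟩⟩ : ArrowSpace (UnitSpace Q X)) =
          ⟨x, y, a⟩ → ∃ h : γ • x = y, a = Quotient.mk (arrowSetoid x y) ⟨γ, h⟩ := by
      intro y hy a h
      injection h with h1 h2 h3
      subst h2
      exact ⟨rfl, (eq_of_heq h3).symm⟩
    obtain ⟨hy, ha⟩ := key rfl _ h
    have h2 : x.SameArrow γ' γ := Quotient.exact ha
    exact fun p hp => (h2.eq (le_max_right _ _) (le_max_left _ _) hp).symm
  · intro h
    have hs : γ' • x = γ • x := UnitSpace.ext_of fun n => by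
      obtain ⟨p, hp⟩ := x.exists_rep (n + (wordLength Q γ + wordLength Q γ'))
      refine ⟨γ • p, ?_, hp.smul γ (by omega)⟩
      rw [h.eq (by omega) (by omega) hp]
      exact hp.smul γ' (by omega)
    have key : ∀ {y : UnitSpace Q X} (hy : γ' • x = y),
        (⟨x, y, Quotient.mk (arrowSetoid x y) ⟨γ', hy⟩⟩ : ArrowSpace (UnitSpace Q X)) =
          arrowMk x γ' := by
      intro y hy
      subst hy
      rfl
    rw [← key hs]
    exact congrArg (fun a => (⟨x, γ • x, a⟩ : ArrowSpace (UnitSpace Q X))) (Quotient.sound h)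

variable (Q X)

/-- Two pairs `(p, y)` and `(q, z)`, where `y` and `z` are vertices of the `n`-balls around `p` and
`q`, are identified if a root-label isomorphism of these balls takes `y` to `z`. -/
def pointedBallSetoid (n : ℕ) : Setoid (Σ p : X, schreierBall Q n p) where
  r a b := ∃ θ : RootLabelIso Q n a.1 b.1, θ.toEquiv a.2 = b.2
  iseqv :=
    { refl := fun a => ⟨RootLabelIso.refl n a.1, rfl⟩
      symm := fun ⟨θ, h⟩ => ⟨θ.symm, by rw [← h]; exact θ.toEquiv.symm_apply_apply _⟩
      trans := fun ⟨θ, h⟩ ⟨η, k⟩ => ⟨θ.trans η, by rw [← k, ← h]; rfl⟩ }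

/-- The set `Fₙ`: the disjoint union over the classes of `n`-balls of the vertex sets of these balls,
together with an extra point `∞ₙ = none`. -/
def PointedBallClass (n : ℕ) : Type u := Option (Quotient (pointedBallSetoid Q X n))

instance (n : ℕ) : TopologicalSpace (PointedBallClass Q X n) := ⊥

variable {Q X}

open scoped Classical in
/-- The component in `Fₙ` of the arrow `g` with range `x`: the class of `(xₙ, γ xₙ)` if
`g = (x, γ)` for some `γ` of length at most `n`, and `∞ₙ` if there is no such `γ`. -/
noncomputable def arrowComponent (n : ℕ) (g : ArrowSpace (UnitSpace Q X)) :
    PointedBallClass Q X n :=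
  if h : ∃ γ : Γ, wordLength Q γ ≤ n ∧ arrowMk g.rng γ = g then
    some (Quotient.mk (pointedBallSetoid Q X n)
      ⟨(g.rng.exists_rep n).choose,
        ⟨h.choose • (g.rng.exists_rep n).choose, smul_mem_schreierBall h.choose_spec.1 _⟩⟩)
  else none

/-- The component does not depend on the choices of `γ` and of the representative of `xₙ`. -/
theorem arrowComponent_arrowMk {n : ℕ} (x : UnitSpace Q X) {γ : Γ} (hγ : wordLength Q γ ≤ n)
    {p : X} (hp : x.Rep n p) :
    arrowComponent n (arrowMk x γ) = some (Quotient.mk (pointedBallSetoid Q X n)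
      ⟨p, ⟨γ • p, smul_mem_schreierBall hγ p⟩⟩) := by
  have h : ∃ γ' : Γ, wordLength Q γ' ≤ n ∧ arrowMk (arrowMk x γ).rng γ' = arrowMk x γ :=
    ⟨γ, hγ, rfl⟩
  refine (dif_pos h).trans (congrArg some (Quotient.sound ?_))
  have hc := ((arrowMk x γ).rng.exists_rep n).choose_spec
  have hs := arrowMk_eq_iff.1 h.choose_spec.2
  obtain ⟨θ⟩ := UnitSpace.Rep.iso hc hp
  refine ⟨θ, Subtype.ext ?_⟩
  change (θ.toEquiv ⟨h.choose • _, smul_mem_schreierBall h.choose_spec.1 _⟩ : X) = γ • p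
  rw [θ.apply_smul h.choose_spec.1]
  exact hs.eq h.choose_spec.1 hγ hp

/-- The topology on the arrows as a subspace of the projective limit of the discrete sets `Fₙ`. -/
noncomputable instance arrowTopology : TopologicalSpace (ArrowSpace (UnitSpace Q X)) :=
  TopologicalSpace.induced (fun g n => arrowComponent n g)
    (inferInstance : TopologicalSpace (∀ n, PointedBallClass Q X n))

end Topology

/-- The groupoid constructed from the Schreier graph of `H`. -/
abbrev URSGroupoid {Γ : Type u} [Group Γ] (Q : GeneratingSystem Γ) (H : Subgroup Γ) : Type u :=
  UnitSpace Q (Γ ⧸ H)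

/-! ### Topological amenability -/

section Amenable

variable {C : Type u} [Groupoid.{u} C]

/-- `(f * f^*)(g) = ∑ f(g h) conj (f(h))`, the sum over all arrows `h` with range the source of `g`
(convolution with respect to the counting measures, for étale groupoids). -/
noncomputable def convStar (f : ArrowSpace C → ℂ) (g : ArrowSpace C) : ℂ :=
  ∑' h : (Σ z : C, g.src ⟶ z),
    f ⟨g.rng, h.1, g.hom ≫ h.2⟩ * starRingEnd ℂ (f ⟨g.src, h.1, h.2⟩)

variable (C)

/-- Topological amenability of an étale groupoid (with its Haar system of counting measures): there
is a net `f_i` in `C_c(𝒢)` such that the functions `u ↦ ∑_{h ∈ 𝒢^u} |f_i(h)|²` on the unit space are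
uniformly bounded and `f_i * f_i^*` converges to `1` uniformly on compact sets of arrows. -/
def IsTopologicallyAmenable [TopologicalSpace (ArrowSpace C)] : Prop :=
  ∃ (ι : Type u) (_ : Nonempty ι) (_ : Preorder ι) (_ : IsDirectedOrder ι)
    (f : ι → CompactlySupportedContinuousMap (ArrowSpace C) ℂ),
    (∃ M : ℝ, ∀ (i : ι) (x : C), ∑' h : (Σ z : C, x ⟶ z), ‖f i ⟨x, h.1, h.2⟩‖ ^ 2 ≤ M) ∧
    ∀ K : Set (ArrowSpace C), IsCompact K →
      TendstoUniformlyOn (fun i => convStar (f i)) (fun _ => 1) Filter.atTop K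

end Amenable

/-!
A unit `x` of the groupoid `𝒢` of `H₀` is a coherent sequence of patterns seen in the Schreier graph
of `H₀`, and minimality of `Z` makes every finite pattern of one Schreier graph occur in all the
others (`IsURS.exists_ballsAgree`). Hence each unit looks, up to any given scale, like some vertex
`p` of `Γ ⧸ H`, and each vertex `p` looks at all scales like a unique unit `x` (`UnitSpace.Matches`,
`UnitSpace.exists_matches_vertex`, `UnitSpace.exists_matches_unit`). Under this correspondence the
arrow `(x, γ)` becomes the vertex `γ p`, the fibre `𝒢ˣ` becomes `Γ ⧸ H`, and
`(f * f^*)(x, γ)` becomes the inner product of the vectors on `Γ ⧸ H` that `f` induces at `p` and at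
`γ p` (`convStar_eq_inner`).

On the topological side, the arrows `(x, γ)` with `l(γ) ≤ n` form a compact open set, and these sets
exhaust `𝒢` (`isCompact_shortArrows`, `exists_subset_shortArrows`). So compact sets of arrows
correspond to bounded distance on the Schreier graph, compact support to uniformly bounded support,
and functions of a single component of the projective limit to local functions.

If the Schreier graph has local property A, then `f(x, γ) = ρ_p(γ p)`, for `p` that looks like `x` at
a sufficiently large scale, is well defined and locally constant because `ρ` is local, and
`|1 - (f * f^*)(x, γ)| ≤ ‖ρ_p - ρ_{γ p}‖`. Conversely, a function `f` with `f * f^*` close to `1` on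
the arrows of length at most `n` is first replaced by a uniformly close one that depends on one
component only (`exists_component_approx`); the vectors which it induces are then local and, after
normalization, satisfy the estimate in local property A (`exists_local_vectors`).
-/

section Combinatorics

variable {Γ : Type u} [Group Γ] {Q : GeneratingSystem Γ}
variable {X : Type u} [MulAction Γ X] {Y : Type u} [MulAction Γ Y]

/-! ### Word length -/

theorem wordLength_inv_le (γ : Γ) : wordLength Q γ⁻¹ ≤ wordLength Q γ := by
  obtain ⟨w, hw, rfl, hl⟩ := exists_word Q γ
  have h := wordLength_le Q (w := (w.map fun q => q⁻¹).reverse) (by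
    intro q hq
    simp only [List.mem_reverse, List.mem_map] at hq
    obtain ⟨p, hp, rfl⟩ := hq
    exact Q.inv_mem p (hw p hp))
  rw [← List.prod_inv_reverse, List.length_reverse, List.length_map] at h
  exact h.trans hl.le

theorem wordLength_inv (γ : Γ) : wordLength Q γ⁻¹ = wordLength Q γ :=
  le_antisymm (wordLength_inv_le γ) (by simpa using wordLength_inv_le (Q := Q) γ⁻¹)

theorem wordLength_generator {q : Γ} (hq : q ∈ Q.carrier) : wordLength Q q ≤ 1 := by
  simpa using wordLength_le Q (w := [q]) (by simpa using hq)

variable (Q) in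
theorem finite_wordLength_le (n : ℕ) : {γ : Γ | wordLength Q γ ≤ n}.Finite := by
  refine ((List.finite_length_le Q.carrier n).image
    fun w => (w.map (Subtype.val : Q.carrier → Γ)).prod).subset ?_
  intro γ hγ
  obtain ⟨w, hw, rfl, hl⟩ := exists_word Q γ
  refine ⟨w.attach.map fun q => ⟨q.1, hw q.1 q.2⟩, ?_, ?_⟩
  · simpa [hl] using hγ
  · simp [List.map_map, Function.comp_def]

/-! ### Vertices with the same coincidences -/

variable (Q) in
/-- The vertices `p` and `r`, possibly of different `Γ`-sets, satisfy the same equations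
`γ p = γ' p` of total length at most `M`. This is a form of isomorphism of balls that makes sense
across Schreier graphs. -/
def BallsAgree (M : ℕ) (p : X) (r : Y) : Prop :=
  ∀ γ γ' : Γ, wordLength Q γ + wordLength Q γ' ≤ M → (γ • p = γ' • p ↔ γ • r = γ' • r)

theorem BallsAgree.of_stabilizer {M : ℕ} {p : X} {r : Y}
    (h : ∀ γ : Γ, wordLength Q γ ≤ M → (γ • p = p ↔ γ • r = r)) : BallsAgree Q M p r := by
  intro γ γ' hl
  have h1 := h (γ'⁻¹ * γ) ((wordLength_mul Q _ _).trans (by rw [wordLength_inv]; omega))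
  rwa [mul_smul, mul_smul, inv_smul_eq_iff, inv_smul_eq_iff] at h1

theorem RootLabelIso.ballsAgree {M : ℕ} {p r : X} (θ : RootLabelIso Q M p r) :
    BallsAgree Q M p r := fun _ _ hl =>
  ⟨θ.smul_eq (by omega) (by omega), θ.symm.smul_eq (by omega) (by omega)⟩

/-- The map between balls of radius `n` that takes `γ p` to `γ r`. -/
noncomputable def ballMap (n : ℕ) (p r : X) (u : schreierBall Q n p) : schreierBall Q n r :=
  ⟨(mem_schreierBall_iff.1 u.2).choose • r,
    smul_mem_schreierBall (mem_schreierBall_iff.1 u.2).choose_spec.1 r⟩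

theorem ballMap_apply {n : ℕ} {p r : X} (h : BallsAgree Q (2 * n) p r) (u : schreierBall Q n p)
    {γ : Γ} (hγ : wordLength Q γ ≤ n) (hu : γ • p = u) : (ballMap n p r u : X) = γ • r := by
  have hc := (mem_schreierBall_iff.1 u.2).choose_spec
  exact (h _ γ (by omega)).1 (hc.2.trans hu.symm)

/-- An edge between vertices of an `n`-ball is an equation of total length at most `2n + 1`. -/
theorem BallsAgree.rootLabelIso {n : ℕ} {p r : X} (h : BallsAgree Q (2 * n + 1) p r) :
    Nonempty (RootLabelIso Q n p r) := by
  have h1 : BallsAgree Q (2 * n) p r := fun γ γ' hl => h γ γ' (by omega)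
  have h2 : BallsAgree Q (2 * n) r p := fun γ γ' hl => (h1 γ γ' hl).symm
  refine ⟨⟨⟨ballMap n p r, ballMap n r p, fun u => ?_, fun u => ?_⟩, fun u hu => ?_,
    fun u v q hq => ?_⟩⟩
  · obtain ⟨γ, hγ, hu⟩ := mem_schreierBall_iff.1 u.2
    exact Subtype.ext ((ballMap_apply h2 _ hγ (ballMap_apply h1 u hγ hu).symm).trans hu)
  · obtain ⟨γ, hγ, hu⟩ := mem_schreierBall_iff.1 u.2
    exact Subtype.ext ((ballMap_apply h1 _ hγ (ballMap_apply h2 u hγ hu).symm).trans hu)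
  · exact (ballMap_apply h1 u (γ := 1) (by simp [wordLength_one]) (by simp [hu])).trans
      (one_smul _ _)
  · obtain ⟨γ, hγ, hu⟩ := mem_schreierBall_iff.1 u.2
    obtain ⟨δ, hδ, hv⟩ := mem_schreierBall_iff.1 v.2
    change _ ↔ q • (ballMap n p r u : X) = ballMap n p r v
    rw [ballMap_apply h1 u hγ hu, ballMap_apply h1 v hδ hv, ← hu, ← hv, ← mul_smul, ← mul_smul]
    have h3 := wordLength_mul Q q γ
    have h4 := wordLength_generator (Q := Q) hq
    exact h _ _ (by omega)

variable (Q) in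
/-- By minimality, every finite pattern of a Schreier graph of a uniformly recurrent subgroup
occurs in every other one. -/
theorem IsURS.exists_ballsAgree {Z : Set (Subgroup Γ)} (hZ : IsURS Z) {H K : Subgroup Γ}
    (hH : H ∈ Z) (hK : K ∈ Z) (M : ℕ) (p : Γ ⧸ K) : ∃ r : Γ ⧸ H, BallsAgree Q M p r := by
  obtain ⟨a, rfl⟩ := QuotientGroup.mk_surjective p
  let U : Set (Subgroup Γ) :=
    ⋂ γ ∈ {γ : Γ | wordLength Q γ ≤ M}, {L | γ ∈ L ↔ γ ∈ conjSubgroup a K}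
  have hU : IsOpen U := by
    refine (finite_wordLength_le Q M).isOpen_biInter fun γ _ => ?_
    classical
    have hc : Continuous fun (L : Subgroup Γ) => decide (γ ∈ L) := by
      have h : Continuous fun (L : Subgroup Γ) (γ : Γ) => decide (γ ∈ L) := by
        convert continuous_induced_dom
      exact (continuous_apply γ).comp h
    have h := (isOpen_discrete {decide (γ ∈ conjSubgroup a K)}).preimage hc
    convert h using 1
    ext L
    simp
  obtain ⟨L, hL, b, rfl⟩ := mem_closure_iff.1 (hZ.minimal H hH (hZ.invariant K hK a)) U hU
    (Set.mem_iInter₂.2 fun _ _ => Iff.rfl)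
  refine ⟨(b : Γ ⧸ H), .of_stabilizer fun γ hγ => ?_⟩
  have key : ∀ (c : Γ) (N : Subgroup Γ), γ • (c : Γ ⧸ N) = c ↔ γ ∈ conjSubgroup c N := by
    intro c N
    change ((γ * c : Γ) : Γ ⧸ N) = c ↔ _
    rw [conjSubgroup, Subgroup.mem_map, eq_comm, QuotientGroup.eq]
    constructor
    · intro h
      exact ⟨_, h, by simp [mul_assoc]⟩
    · rintro ⟨x, hx, rfl⟩
      simpa [mul_assoc] using hx
  rw [key, key]
  exact (Set.mem_iInter₂.1 hL γ hγ).symm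

/-! ### Units and vertices -/

/-- The vertex `p` looks like the unit `x` up to scale `M`: the arrows `(x, γ)` and `(x, γ')` agree
if and only if `γ p = γ' p`, for total length at most `M`. -/
def UnitSpace.Matches (x : UnitSpace Q Y) (M : ℕ) (p : X) : Prop :=
  ∀ γ γ' : Γ, wordLength Q γ + wordLength Q γ' ≤ M → (x.SameArrow γ γ' ↔ γ • p = γ' • p)

namespace UnitSpace

theorem Rep.sameArrow_iff {x : UnitSpace Q X} {m : ℕ} {p : X} (hp : x.Rep m p) {γ γ' : Γ}
    (hγ : wordLength Q γ ≤ m) (hγ' : wordLength Q γ' ≤ m) :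
    x.SameArrow γ γ' ↔ γ • p = γ' • p :=
  ⟨fun h => h.eq hγ hγ' hp, SameArrow.of_eq hγ hγ' hp⟩

theorem Rep.matches {x : UnitSpace Q X} {m : ℕ} {p : X} (hp : x.Rep m p) : x.Matches m p :=
  fun _ _ hl => hp.sameArrow_iff (by omega) (by omega)

theorem Matches.mono {x : UnitSpace Q Y} {M N : ℕ} {p : X} (h : x.Matches M p) (hN : N ≤ M) :
    x.Matches N p := fun γ γ' hl => h γ γ' (hl.trans hN)

theorem Matches.trans {X' : Type u} [MulAction Γ X'] {x : UnitSpace Q Y} {M : ℕ} {p : X} {r : X'}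
    (h : x.Matches M p) (k : BallsAgree Q M p r) : x.Matches M r :=
  fun γ γ' hl => (h γ γ' hl).trans (k γ γ' hl)

theorem Matches.ballsAgree {X' : Type u} [MulAction Γ X'] {x : UnitSpace Q Y} {M : ℕ} {p : X}
    {r : X'} (h : x.Matches M p) (k : x.Matches M r) : BallsAgree Q M p r :=
  fun γ γ' hl => (h γ γ' hl).symm.trans (k γ γ' hl)

theorem sameArrow_smul_iff (x : UnitSpace Q Y) (γ γ' δ : Γ) :
    (δ • x).SameArrow γ γ' ↔ x.SameArrow (γ * δ) (γ' * δ) := by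
  obtain ⟨p, hp⟩ := x.exists_rep (wordLength Q γ + wordLength Q γ' + wordLength Q δ)
  have h1 := wordLength_mul Q γ δ
  have h2 := wordLength_mul Q γ' δ
  rw [(hp.smul δ le_rfl).sameArrow_iff (by omega) (by omega),
    hp.sameArrow_iff (by omega) (by omega), mul_smul, mul_smul]

theorem Matches.smul {x : UnitSpace Q Y} {M N : ℕ} {p : X} (h : x.Matches M p) (δ : Γ)
    (hN : N + 2 * wordLength Q δ ≤ M) : (δ • x).Matches N (δ • p) := by
  intro γ γ' hl
  have h1 := wordLength_mul Q γ δ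
  have h2 := wordLength_mul Q γ' δ
  rw [sameArrow_smul_iff, h _ _ (by omega), mul_smul, mul_smul]

variable (Q) in
theorem exists_matches_vertex {Z : Set (Subgroup Γ)} (hZ : IsURS Z) {H H₀ : Subgroup Γ}
    (hH : H ∈ Z) (hH₀ : H₀ ∈ Z) (x : UnitSpace Q (Γ ⧸ H₀)) (M : ℕ) :
    ∃ p : Γ ⧸ H, x.Matches M p := by
  obtain ⟨r, hr⟩ := x.exists_rep M
  obtain ⟨p, hp⟩ := hZ.exists_ballsAgree Q hH hH₀ M r
  exact ⟨p, hr.matches.trans hp⟩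

variable (Q) in
/-- Every vertex of the Schreier graph of `H` determines a unit of the groupoid of `H₀`. -/
theorem exists_matches_unit {Z : Set (Subgroup Γ)} (hZ : IsURS Z) {H H₀ : Subgroup Γ}
    (hH : H ∈ Z) (hH₀ : H₀ ∈ Z) (p : Γ ⧸ H) :
    ∃ x : UnitSpace Q (Γ ⧸ H₀), ∀ M, x.Matches M p := by
  choose r hr using fun n : ℕ => hZ.exists_ballsAgree Q hH₀ hH (2 * n + 1) p
  have hiso : ∀ n, Nonempty (RootLabelIso Q n (r (n + 1)) (r n)) := fun n =>
    BallsAgree.rootLabelIso fun γ γ' hl =>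
      (hr (n + 1) γ γ' (by omega)).symm.trans (hr n γ γ' hl)
  let x : UnitSpace Q (Γ ⧸ H₀) :=
    ⟨fun n => ballClass Q n (r n), fun n => (ballClass_eq_iff Q).2 (hiso n)⟩
  refine ⟨x, fun M γ γ' hl => ?_⟩
  have hx : x.Rep M (r M) := rfl
  rw [hx.sameArrow_iff (by omega) (by omega)]
  exact (hr M γ γ' (by omega)).symm

theorem coord_eq_of_matches {X' : Type u} [MulAction Γ X'] {x y : UnitSpace Q Y} {n : ℕ} {p : X}
    {p' : X'} (hx : x.Matches (2 * n + 1) p) (hy : y.Matches (2 * n + 1) p')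
    (h : BallsAgree Q (2 * n + 1) p p') : x.coord n = y.coord n := by
  obtain ⟨r, hr⟩ := x.exists_rep (2 * n + 1)
  obtain ⟨s, hs⟩ := y.exists_rep (2 * n + 1)
  have hrs : BallsAgree Q (2 * n + 1) r s :=
    hr.matches.ballsAgree ((hx.trans h).trans (hy.ballsAgree hs.matches))
  exact (hr.of_le (by omega : n ≤ 2 * n + 1)).trans
    (((ballClass_eq_iff Q).2 hrs.rootLabelIso).trans (hs.of_le (by omega : n ≤ 2 * n + 1)).symm)

theorem eq_of_matches {x y : UnitSpace Q Y} {p : X} (hx : ∀ M, x.Matches M p)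
    (hy : ∀ M, y.Matches M p) : x = y :=
  UnitSpace.ext (funext fun _ => coord_eq_of_matches (hx _) (hy _) fun _ _ _ => Iff.rfl)

end UnitSpace

end Combinatorics

section Arrows

variable {Γ : Type u} [Group Γ] {Q : GeneratingSystem Γ}
variable {X : Type u} [MulAction Γ X]

/-! ### Arrows as pairs -/

theorem mk_eq_arrowMk {x y : UnitSpace Q X} {γ : Γ} (h : γ • x = y) :
    (⟨x, y, Quotient.mk (arrowSetoid x y) ⟨γ, h⟩⟩ : ArrowSpace (UnitSpace Q X)) = arrowMk x γ := by
  subst h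
  rfl

theorem exists_arrowMk_eq (g : ArrowSpace (UnitSpace Q X)) : ∃ γ : Γ, arrowMk g.rng γ = g := by
  obtain ⟨x, y, a⟩ := g
  induction a using Quotient.inductionOn with
  | h γ => exact ⟨γ.1, (mk_eq_arrowMk γ.2).symm⟩

/-- The arrow `(x, γ)` as an element of the fibre `𝒢ˣ` of arrows with range `x`, encoded as the pair
of its source and the morphism. -/
noncomputable def fiberMk (x : UnitSpace Q X) (γ : Γ) : Σ z : UnitSpace Q X, x ⟶ z :=
  ⟨(arrowMk x γ).src, (arrowMk x γ).hom⟩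

/-- An element of the fibre `𝒢ˣ` as an arrow. -/
def fiberArrow {x : UnitSpace Q X} (h : Σ z : UnitSpace Q X, x ⟶ z) :
    ArrowSpace (UnitSpace Q X) :=
  ⟨x, h.1, h.2⟩

theorem fiberArrow_injective (x : UnitSpace Q X) :
    Function.Injective (fiberArrow : (Σ z : UnitSpace Q X, x ⟶ z) → _) := by
  rintro ⟨z, a⟩ ⟨w, b⟩ h
  injection h with h1 h2 h3
  change z = w at h2
  subst h2
  exact congrArg (Sigma.mk z) (eq_of_heq h3)

theorem fiberMk_eq_iff {x : UnitSpace Q X} {γ γ' : Γ} :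
    fiberMk x γ = fiberMk x γ' ↔ x.SameArrow γ γ' := by
  rw [← arrowMk_eq_iff]
  exact (fiberArrow_injective x).eq_iff.symm

theorem arrowMk_comp (x : UnitSpace Q X) (δ γ : Γ) :
    (⟨x, (fiberMk (δ • x) γ).1, (arrowMk x δ).hom ≫ (fiberMk (δ • x) γ).2⟩ :
      ArrowSpace (UnitSpace Q X)) = arrowMk x (γ * δ) :=
  mk_eq_arrowMk (mul_smul γ δ x)

/-! ### The topology of the arrow space -/

variable (Q X) in
/-- The arrows `(x, γ)` with `γ` of length at most `R`. -/
def shortArrows (R : ℕ) : Set (ArrowSpace (UnitSpace Q X)) :=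
  {g | ∃ γ : Γ, wordLength Q γ ≤ R ∧ arrowMk g.rng γ = g}

theorem arrowMk_mem_shortArrows (x : UnitSpace Q X) {γ : Γ} {R : ℕ} (h : wordLength Q γ ≤ R) :
    arrowMk x γ ∈ shortArrows Q X R := ⟨γ, h, rfl⟩

theorem shortArrows_mono {R R' : ℕ} (h : R ≤ R') : shortArrows Q X R ⊆ shortArrows Q X R' :=
  fun _ ⟨γ, hγ, hg⟩ => ⟨γ, hγ.trans h, hg⟩

theorem arrowComponent_eq_none_iff {n : ℕ} {g : ArrowSpace (UnitSpace Q X)} :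
    arrowComponent n g = none ↔ g ∉ shortArrows Q X n := by
  classical
  by_cases h : g ∈ shortArrows Q X n
  · have h1 : arrowComponent n g ≠ none := by
      obtain ⟨γ, hγ, hg⟩ := h
      obtain ⟨p, hp⟩ := g.rng.exists_rep n
      rw [← hg, arrowComponent_arrowMk _ hγ hp]
      exact Option.some_ne_none _
    exact ⟨fun h' => (h1 h').elim, fun h' => (h' h).elim⟩
  · exact ⟨fun _ => h, fun _ => dif_neg h⟩

theorem mem_shortArrows_iff_of_component_eq {n : ℕ} {g h : ArrowSpace (UnitSpace Q X)}
    (hc : arrowComponent n g = arrowComponent n h) :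
    g ∈ shortArrows Q X n ↔ h ∈ shortArrows Q X n := by
  rw [← not_iff_not, ← arrowComponent_eq_none_iff, hc, arrowComponent_eq_none_iff]

/-- Arrows with the same finite `n`-component are given by the same group element at units that
agree at level `n`. -/
theorem eq_arrowMk_of_component_eq {n : ℕ} {x : UnitSpace Q X} {γ : Γ} (hγ : wordLength Q γ ≤ n)
    {g : ArrowSpace (UnitSpace Q X)} (hc : arrowComponent n (arrowMk x γ) = arrowComponent n g) :
    g = arrowMk g.rng γ ∧ ∃ r, x.Rep n r ∧ g.rng.Rep n r := by
  obtain ⟨γ', hγ', hg⟩ :=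
    (mem_shortArrows_iff_of_component_eq hc).1 (arrowMk_mem_shortArrows x hγ)
  obtain ⟨p, hp⟩ := x.exists_rep n
  obtain ⟨q, hq⟩ := g.rng.exists_rep n
  rw [← hg, arrowComponent_arrowMk x hγ hp, arrowComponent_arrowMk _ hγ' hq] at hc
  obtain ⟨θ, hθ⟩ := Quotient.exact (Option.some.inj hc)
  have h1 : γ • q = γ' • q :=
    (θ.apply_smul hγ (smul_mem_schreierBall hγ p)).symm.trans (congrArg Subtype.val hθ)
  refine ⟨?_, p, hp, hq.trans ((ballClass_eq_iff Q).2 ⟨θ⟩).symm⟩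
  rw [arrowMk_eq_iff.2 (UnitSpace.SameArrow.of_eq hγ hγ' hq h1)]
  exact hg.symm

theorem mem_shortArrows_of_component_eq {m n : ℕ} (hmn : m ≤ n)
    {g h : ArrowSpace (UnitSpace Q X)} (hc : arrowComponent n g = arrowComponent n h)
    (hg : g ∈ shortArrows Q X m) : h ∈ shortArrows Q X m := by
  obtain ⟨γ, hγ, hg⟩ := hg
  rw [← hg] at hc
  exact ⟨γ, hγ, (eq_arrowMk_of_component_eq (hγ.trans hmn) hc).1.symm⟩

theorem arrowComponent_eq_of_le {m n : ℕ} (hmn : m ≤ n) {g h : ArrowSpace (UnitSpace Q X)}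
    (hc : arrowComponent n g = arrowComponent n h) : arrowComponent m g = arrowComponent m h := by
  by_cases hg : g ∈ shortArrows Q X m
  · obtain ⟨γ, hγ, hg⟩ := hg
    rw [← hg] at hc ⊢
    obtain ⟨hh, r, hr, hr'⟩ := eq_arrowMk_of_component_eq (hγ.trans hmn) hc
    rw [hh, arrowComponent_arrowMk _ hγ (hr.of_le hmn), arrowComponent_arrowMk _ hγ (hr'.of_le hmn)]
  · have hh : h ∉ shortArrows Q X m := fun hh => hg (mem_shortArrows_of_component_eq hmn hc.symm hh)
    rw [arrowComponent_eq_none_iff.2 hg, arrowComponent_eq_none_iff.2 hh]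

instance (n : ℕ) : DiscreteTopology (PointedBallClass Q X n) := ⟨rfl⟩

theorem continuous_arrowComponent (n : ℕ) :
    Continuous (arrowComponent n : ArrowSpace (UnitSpace Q X) → PointedBallClass Q X n) := by
  have h : Continuous fun (g : ArrowSpace (UnitSpace Q X)) (n : ℕ) => arrowComponent n g :=
    continuous_induced_dom
  exact (continuous_apply n).comp h

theorem isClopen_shortArrows (n : ℕ) : IsClopen (shortArrows Q X n) := by
  have h : shortArrows Q X n =
      arrowComponent n ⁻¹' {c : PointedBallClass Q X n | c ≠ none} := by
    ext g
    exact not_not.symm.trans (not_congr arrowComponent_eq_none_iff).symm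
  rw [h]
  exact (isClopen_discrete _).preimage (continuous_arrowComponent n)

/-- The sets of arrows with a given `n`-component are a basis of the topology. -/
theorem exists_component_subset {U : Set (ArrowSpace (UnitSpace Q X))} (hU : IsOpen U)
    {g : ArrowSpace (UnitSpace Q X)} (hg : g ∈ U) :
    ∃ n, ∀ h, arrowComponent n h = arrowComponent n g → h ∈ U := by
  obtain ⟨V, hV, rfl⟩ := isOpen_induced_iff.1 hU
  obtain ⟨I, W, hW, hIW⟩ := isOpen_pi_iff.1 hV _ hg
  refine ⟨I.sup id, fun h hh => hIW fun i hi => ?_⟩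
  have h1 : arrowComponent i h = arrowComponent i g :=
    arrowComponent_eq_of_le (Finset.le_sup (f := id) hi) hh
  change arrowComponent i h ∈ W i
  rw [h1]
  exact (hW i hi).2

theorem isOpen_component (n : ℕ) (g : ArrowSpace (UnitSpace Q X)) :
    IsOpen {h | arrowComponent n h = arrowComponent n g} :=
  (isOpen_discrete {arrowComponent n g}).preimage (continuous_arrowComponent n)

theorem continuous_of_component {E : Type*} [TopologicalSpace E]
    {f : ArrowSpace (UnitSpace Q X) → E} (n : ℕ)
    (hf : ∀ g h, arrowComponent n g = arrowComponent n h → f g = f h) : Continuous f :=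
  ((IsLocallyConstant.iff_exists_open f).2 fun g =>
    ⟨_, isOpen_component n g, rfl, fun h hh => hf h g hh⟩).continuous

/-! ### Compactness -/

variable (Q X) in
/-- There are finitely many isomorphism classes of `n`-balls. -/
theorem finite_ballClass (n : ℕ) : Finite (BallClass Q X n) := by
  let S := {γ : Γ // wordLength Q γ ≤ 2 * n + 1}
  have : Finite S := (finite_wordLength_le Q (2 * n + 1)).to_subtype
  let φ : BallClass Q X n → Set (S × S) :=
    fun a => {s | (s.1 : Γ) • Quotient.out a = (s.2 : Γ) • Quotient.out a}
  refine Finite.of_injective φ fun a b hab => ?_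
  rw [← Quotient.out_eq a, ← Quotient.out_eq b]
  refine (ballClass_eq_iff Q).2 (BallsAgree.rootLabelIso fun γ γ' hl => ?_)
  exact Set.ext_iff.1 hab (⟨γ, by omega⟩, ⟨γ', by omega⟩)

/-- The coherent sequences form a closed subset of a product of finite discrete spaces. -/
theorem isCompact_units :
    letI : ∀ n, TopologicalSpace (BallClass Q X n) := fun _ => ⊥
    IsCompact (Set.range (UnitSpace.coord : UnitSpace Q X → ∀ n, BallClass Q X n)) := by
  let _ : ∀ n, TopologicalSpace (BallClass Q X n) := fun _ => ⊥
  have : ∀ n, DiscreteTopology (BallClass Q X n) := fun _ => ⟨rfl⟩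
  have := finite_ballClass Q X
  have h : Set.range (UnitSpace.coord : UnitSpace Q X → ∀ n, BallClass Q X n) =
      ⋂ n, {c | BallClass.connect Q n (c (n + 1)) = c n} := by
    ext c
    rw [Set.mem_iInter]
    exact ⟨fun ⟨x, hx⟩ n => hx ▸ x.connect_coord n, fun hc => ⟨⟨c, hc⟩, rfl⟩⟩
  rw [h]
  exact (isClosed_iInter fun n => isClosed_eq
    ((continuous_of_discreteTopology (f := BallClass.connect (X := X) Q n)).comp
      (continuous_apply _)) (continuous_apply n)).isCompact

theorem arrowComponent_arrowMk_eq {n m : ℕ} {x y : UnitSpace Q X} {γ : Γ} (hn : n ≤ m)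
    (hγ : wordLength Q γ ≤ m) (h : x.coord m = y.coord m) :
    arrowComponent n (arrowMk x γ) = arrowComponent n (arrowMk y γ) := by
  obtain ⟨r, hr⟩ := x.exists_rep m
  refine arrowComponent_eq_of_le hn ?_
  rw [arrowComponent_arrowMk x hγ hr, arrowComponent_arrowMk y hγ (h.symm.trans hr)]

theorem isCompact_range_arrowMk (γ : Γ) :
    IsCompact (Set.range fun x : UnitSpace Q X => arrowMk x γ) := by
  let _ : ∀ n, TopologicalSpace (BallClass Q X n) := fun _ => ⊥
  have : ∀ n, DiscreteTopology (BallClass Q X n) := fun _ => ⟨rfl⟩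
  let _ : TopologicalSpace (UnitSpace Q X) := .induced UnitSpace.coord inferInstance
  have hcoord : Continuous (UnitSpace.coord : UnitSpace Q X → _) := continuous_induced_dom
  have : CompactSpace (UnitSpace Q X) := by
    rw [← isCompact_univ_iff, Topology.IsInducing.isCompact_iff ⟨rfl⟩, Set.image_univ]
    exact isCompact_units
  refine isCompact_range (continuous_induced_rng.2 (continuous_pi fun n => ?_))
  refine ((IsLocallyConstant.iff_exists_open _).2 fun x => ?_).continuous
  refine ⟨_, (isOpen_discrete {x.coord (n + wordLength Q γ)}).preimage
    ((continuous_apply _).comp hcoord), rfl, fun y hy => ?_⟩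
  exact arrowComponent_arrowMk_eq (Nat.le_add_right _ _) (Nat.le_add_left _ _) hy

theorem isCompact_shortArrows (R : ℕ) : IsCompact (shortArrows Q X R) := by
  have h : shortArrows Q X R =
      ⋃ γ ∈ {γ : Γ | wordLength Q γ ≤ R}, Set.range fun x : UnitSpace Q X => arrowMk x γ := by
    ext g
    simp only [Set.mem_iUnion₂]
    constructor
    · rintro ⟨γ, hγ, hg⟩
      exact ⟨γ, hγ, g.rng, hg⟩
    · rintro ⟨γ, hγ, x, rfl⟩
      exact arrowMk_mem_shortArrows x hγ
  rw [h]
  exact (finite_wordLength_le Q R).isCompact_biUnion fun γ _ => isCompact_range_arrowMk γ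

theorem exists_subset_shortArrows {K : Set (ArrowSpace (UnitSpace Q X))} (hK : IsCompact K) :
    ∃ R, K ⊆ shortArrows Q X R := by
  refine hK.elim_directed_cover _ (fun R => (isClopen_shortArrows R).isOpen) (fun g _ => ?_)
    (Monotone.directed_le fun _ _ h => shortArrows_mono h)
  obtain ⟨γ, hγ⟩ := exists_arrowMk_eq g
  exact Set.mem_iUnion.2 ⟨wordLength Q γ, γ, le_rfl, hγ⟩

theorem hasCompactSupport_of_shortArrows {f : ArrowSpace (UnitSpace Q X) → ℂ} {R : ℕ}
    (hf : ∀ g, g ∉ shortArrows Q X R → f g = 0) : HasCompactSupport f :=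
  (isCompact_shortArrows R).of_isClosed_subset (isClosed_tsupport f)
    (closure_minimal (fun g hg => by_contra fun h => hg (hf g h))
      (isClopen_shortArrows R).isClosed)

/-- A continuous function with compact support is uniformly approximated by functions that depend
on one component only and have the same bound on their supports. -/
theorem exists_component_approx {f : ArrowSpace (UnitSpace Q X) → ℂ} (hf : Continuous f) {R : ℕ}
    (hR : ∀ g, g ∉ shortArrows Q X R → f g = 0) {δ : ℝ} (hδ : 0 < δ) :
    ∃ (N : ℕ) (f' : ArrowSpace (UnitSpace Q X) → ℂ), R ≤ N ∧
      (∀ g h, arrowComponent N g = arrowComponent N h → f' g = f' h) ∧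
      (∀ g, g ∉ shortArrows Q X R → f' g = 0) ∧ ∀ g, ‖f g - f' g‖ ≤ δ := by
  -- `U N` consists of the arrows around which the component `N` controls `f` up to `δ`.
  let U : ℕ → Set (ArrowSpace (UnitSpace Q X)) := fun N =>
    {g | ∀ h h', arrowComponent N h = arrowComponent N g → arrowComponent N h' = arrowComponent N g →
      ‖f h - f h'‖ ≤ δ}
  have hU : ∀ N, IsOpen (U N) := fun N => isOpen_iff_forall_mem_open.2 fun g hg =>
    ⟨_, fun k hk h h' hh hh' => hg h h' (hh.trans hk) (hh'.trans hk), isOpen_component N g, rfl⟩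
  have hmono : Monotone U := fun m n hmn g hg h h' hh hh' =>
    hg h h' (arrowComponent_eq_of_le hmn hh) (arrowComponent_eq_of_le hmn hh')
  obtain ⟨N, hN⟩ := (isCompact_shortArrows R).elim_directed_cover U hU (fun g _ => by
    obtain ⟨m, hm⟩ := exists_component_subset
      (Metric.isOpen_ball.preimage hf : IsOpen (f ⁻¹' Metric.ball (f g) (δ / 2)))
      (g := g) (Metric.mem_ball_self (half_pos hδ))
    refine Set.mem_iUnion.2 ⟨m, fun h h' hh hh' => ?_⟩
    have h1 : dist (f h) (f g) < δ / 2 := hm h hh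
    have h2 : dist (f h') (f g) < δ / 2 := hm h' hh'
    rw [← dist_eq_norm]
    linarith [dist_triangle_right (f h) (f h') (f g)]) hmono.directed_le
  have hNR := hN.trans (hmono (le_max_left N R))
  rcases isEmpty_or_nonempty (ArrowSpace (UnitSpace Q X)) with _ | _
  · exact ⟨R, f, le_rfl, isEmptyElim, hR, isEmptyElim⟩
  -- The approximation is evaluated at a chosen arrow with the same component.
  let c : ArrowSpace (UnitSpace Q X) → ArrowSpace (UnitSpace Q X) := fun g =>
    Function.invFun (arrowComponent (max N R)) (arrowComponent (max N R) g)
  have hc : ∀ g, arrowComponent (max N R) (c g) = arrowComponent (max N R) g := fun g =>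
    Function.invFun_eq ⟨g, rfl⟩
  have h0 : ∀ g, g ∉ shortArrows Q X R → f (c g) = 0 := fun g hg =>
    hR _ fun h => hg (mem_shortArrows_of_component_eq (le_max_right N R) (hc g) h)
  refine ⟨max N R, fun g => f (c g), le_max_right _ _, fun g h hgh => ?_, h0, fun g => ?_⟩
  · simp only [c, hgh]
  · by_cases hg : g ∈ shortArrows Q X R
    · exact hNR hg g (c g) rfl (hc g)
    · simpa only [hR g hg, h0 g hg, sub_zero, norm_zero] using hδ.le

end Arrows

section Vectors

variable {Γ : Type u} [Group Γ] {Q : GeneratingSystem Γ}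
variable {X : Type u} [MulAction Γ X] {Y : Type u} [MulAction Γ Y]

/-! ### Fibres of the groupoid and vertices of Schreier graphs -/

theorem RootLabelIso.smul_eq_iff {M : ℕ} {p r : X} (θ : RootLabelIso Q M p r) {γ γ' : Γ}
    (hγ : wordLength Q γ ≤ M) (hγ' : wordLength Q γ' ≤ M) : γ • p = γ' • p ↔ γ • r = γ' • r :=
  ⟨θ.smul_eq hγ hγ', θ.symm.smul_eq hγ hγ'⟩

/-- A sum over short arrows in the fibre at `y` is a sum over a ball around a vertex that looks like
`y`. -/
theorem tsum_fiber_eq {E : Type*} [AddCommMonoid E] [TopologicalSpace E] {y : UnitSpace Q Y}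
    {M R : ℕ} {q : X} (hy : y.Matches M q) (hM : 2 * R ≤ M)
    {F : (Σ z : UnitSpace Q Y, y ⟶ z) → E} {G : X → E}
    (hF : ∀ h, F h ≠ 0 → ∃ γ : Γ, wordLength Q γ ≤ R ∧ fiberMk y γ = h)
    (hG : ∀ z, G z ≠ 0 → z ∈ schreierBall Q R q)
    (hFG : ∀ γ : Γ, wordLength Q γ ≤ R → F (fiberMk y γ) = G (γ • q)) :
    ∑' h, F h = ∑' z, G z := by
  choose t ht htq using fun z : Function.support G => mem_schreierBall_iff.1 (hG z.1 z.2)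
  refine tsum_eq_tsum_of_ne_zero_bij (fun z => fiberMk y (t z)) (fun z w hzw => ?_)
    (fun h hh => ?_) fun z => (hFG _ (ht z)).trans (congrArg G (htq z))
  · have hz := ht z
    have hw := ht w
    have h := (hy _ _ (by omega)).1 (fiberMk_eq_iff.1 hzw)
    exact Subtype.ext ((htq z).symm.trans (h.trans (htq w)))
  · obtain ⟨γ, hγ, rfl⟩ := hF h hh
    let z : Function.support G := ⟨γ • q, by
      rw [Function.mem_support, ← hFG γ hγ]
      exact hh⟩
    have hz := ht z
    exact ⟨z, fiberMk_eq_iff.2 ((hy _ _ (by omega)).2 (htq z))⟩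

theorem exists_fiberMk_eq_of_ne_zero {F : ArrowSpace (UnitSpace Q Y) → ℂ} {R : ℕ}
    (hF : ∀ g, g ∉ shortArrows Q Y R → F g = 0) {y : UnitSpace Q Y}
    {h : Σ z : UnitSpace Q Y, y ⟶ z} (hh : F ⟨y, h.1, h.2⟩ ≠ 0) :
    ∃ γ : Γ, wordLength Q γ ≤ R ∧ fiberMk y γ = h := by
  obtain ⟨γ, hγ, hg⟩ := not_imp_comm.1 (hF (fiberArrow h)) hh
  exact ⟨γ, hγ, fiberArrow_injective y hg⟩

/-- The convolution `F * F^*` at the arrow `(x, δ)` is an inner product of vectors on a Schreier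
graph, if these vectors represent the restrictions of `F` to the fibres at `x` and `δ x`. -/
theorem convStar_eq_inner {F : ArrowSpace (UnitSpace Q Y) → ℂ} {R M : ℕ}
    (hF : ∀ g, g ∉ shortArrows Q Y R → F g = 0) {x : UnitSpace Q Y} {δ : Γ} {q : X}
    (hx : (δ • x).Matches M q) (hM : 2 * R ≤ M) {a b : lp (fun _ : X => ℂ) 2}
    (hb : ∀ z, b z ≠ 0 → z ∈ schreierBall Q R q)
    (hFa : ∀ γ : Γ, wordLength Q γ ≤ R → F (arrowMk x (γ * δ)) = a (γ • q))
    (hFb : ∀ γ : Γ, wordLength Q γ ≤ R → F (arrowMk (δ • x) γ) = b (γ • q)) :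
    convStar F (arrowMk x δ) = inner ℂ b a := by
  rw [lp.inner_eq_tsum]
  refine tsum_fiber_eq (G := fun z => inner ℂ (b z) (a z)) hx hM (fun h hh => ?_) (fun z hz => ?_)
    (fun γ hγ => ?_)
  · refine exists_fiberMk_eq_of_ne_zero hF fun h0 => hh ?_
    have h1 : F ⟨(arrowMk x δ).src, h.1, h.2⟩ = 0 := h0
    rw [h1, map_zero, mul_zero]
  · exact hb z fun h0 => hz (by simp only [h0, inner_zero_left])
  · have h1 : F ⟨x, (fiberMk (δ • x) γ).1, (arrowMk x δ).hom ≫ (fiberMk (δ • x) γ).2⟩ =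
        a (γ • q) := by
      rw [arrowMk_comp, hFa γ hγ]
    have h2 : F ⟨δ • x, (fiberMk (δ • x) γ).1, (fiberMk (δ • x) γ).2⟩ = b (γ • q) := hFb γ hγ
    exact congrArg₂ (fun s t => s * starRingEnd ℂ t) h1 h2

/-! ### Vectors in `ℓ²` -/

theorem lp_two_norm_sq {ι : Type*} (a : lp (fun _ : ι => ℂ) 2) : ‖a‖ ^ 2 = ∑' z, ‖a z‖ ^ 2 := by
  have h := lp.norm_rpow_eq_tsum (p := 2) (by norm_num) a
  simpa using h

theorem lp_two_norm_sq_le {ι : Type*} (a : lp (fun _ : ι => ℂ) 2) (s : Finset ι) {c : ℝ}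
    (hs : ∀ z, z ∉ s → a z = 0) (hc : ∀ z, ‖a z‖ ≤ c) : ‖a‖ ^ 2 ≤ s.card * c ^ 2 := by
  rw [lp_two_norm_sq, tsum_eq_sum (s := s) fun z hz => by simp [hs z hz], ← nsmul_eq_mul]
  exact Finset.sum_le_card_nsmul _ _ _ fun z _ => pow_le_pow_left₀ (norm_nonneg _) (hc z) 2

theorem norm_normalize_sub_normalize_le {E : Type*} [NormedAddCommGroup E] [NormedSpace ℝ E]
    {v w : E} (hv : v ≠ 0) (hw : w ≠ 0) :
    ‖‖v‖⁻¹ • v - ‖w‖⁻¹ • w‖ ≤ 2 * ‖v - w‖ / ‖v‖ := by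
  have hv' : 0 < ‖v‖ := norm_pos_iff.2 hv
  have hw' : 0 < ‖w‖ := norm_pos_iff.2 hw
  have h1 : ‖v‖⁻¹ • v - ‖w‖⁻¹ • w = ‖v‖⁻¹ • (v - w) + (‖v‖⁻¹ - ‖w‖⁻¹) • w := by
    rw [smul_sub, sub_smul]
    abel
  have h2 : ‖(‖v‖⁻¹ - ‖w‖⁻¹) • w‖ ≤ ‖v‖⁻¹ * ‖v - w‖ := by
    have h3 : (‖v‖⁻¹ - ‖w‖⁻¹) * ‖w‖ = ‖v‖⁻¹ * (‖w‖ - ‖v‖) := by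
      field_simp
    rw [norm_smul, ← abs_of_pos hw', Real.norm_eq_abs, ← abs_mul, abs_of_pos hw', h3, abs_mul,
      abs_of_pos (inv_pos.2 hv'), norm_sub_rev v w]
    exact mul_le_mul_of_nonneg_left (abs_norm_sub_norm_le w v) (inv_pos.2 hv').le
  calc ‖‖v‖⁻¹ • v - ‖w‖⁻¹ • w‖ ≤ ‖v‖⁻¹ * ‖v - w‖ + ‖v‖⁻¹ * ‖v - w‖ := by
        rw [h1]
        refine (norm_add_le _ _).trans (add_le_add ?_ h2)
        rw [norm_smul, norm_inv, norm_norm]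
    _ = 2 * ‖v - w‖ / ‖v‖ := by ring

theorem norm_one_sub_inner_le {E : Type*} [NormedAddCommGroup E] [InnerProductSpace ℂ E] {a b : E}
    (ha : ‖a‖ = 1) : ‖1 - inner ℂ b a‖ ≤ ‖a - b‖ := by
  have h : (1 : ℂ) = inner ℂ a a := by
    rw [inner_self_eq_norm_sq_to_K, ha]
    simp
  rw [h, ← inner_sub_left]
  simpa [ha] using norm_inner_le_norm (𝕜 := ℂ) (a - b) a

/-- If the Gram matrix of `a` and `b` is close to the all-one matrix, then `a` is close to `b`. -/
theorem norm_sub_sq_le_of_inner {E : Type*} [NormedAddCommGroup E] [InnerProductSpace ℂ E] {a b : E}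
    {ε : ℝ} (ha : ‖1 - inner ℂ a a‖ ≤ ε) (hb : ‖1 - inner ℂ b b‖ ≤ ε)
    (hab : ‖1 - inner ℂ b a‖ ≤ ε) : ‖a - b‖ ^ 2 ≤ 4 * ε := by
  have key : ∀ z : ℂ, ‖1 - z‖ ≤ ε → |1 - z.re| ≤ ε := fun z hz => by
    simpa using (Complex.abs_re_le_norm (1 - z)).trans hz
  have h1 := abs_le.1 (key _ ha)
  have h2 := abs_le.1 (key _ hb)
  have h3 := abs_le.1 (key _ hab)
  have h4 := norm_sub_sq (𝕜 := ℂ) b a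
  rw [← inner_self_eq_norm_sq (𝕜 := ℂ) a, ← inner_self_eq_norm_sq (𝕜 := ℂ) b] at h4
  simp only [RCLike.re_eq_complex_re] at h4
  rw [norm_sub_rev, h4]
  linarith

/-! ### From vectors on the Schreier graph to functions on the groupoid -/

/-- Local vectors on the Schreier graph of `H` induce a function on the groupoid of `H₀`. A vertex
that looks like `x` up to scale `2 * R + 1` is determined up to isomorphism of `R`-balls; the
additional `l(δ)` decides whether `(x, δ)` equals an arrow of length at most `R`. -/
theorem exists_function_of_local_vectors {Z : Set (Subgroup Γ)} (hZ : IsURS Z) {H H₀ : Subgroup Γ}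
    (hH : H ∈ Z) (hH₀ : H₀ ∈ Z) {R : ℕ} (ρ : Γ ⧸ H → lp (fun _ : Γ ⧸ H => ℂ) 2)
    (hsupp : ∀ x y : Γ ⧸ H, y ∉ schreierBall Q R x → ρ x y = 0)
    (hloc : ∀ (x y : Γ ⧸ H) (θ : RootLabelIso Q R x y) (z : schreierBall Q R x),
      ρ y (θ.toEquiv z) = ρ x z) :
    ∃ f : CompactlySupportedContinuousMap (ArrowSpace (URSGroupoid Q H₀)) ℂ,
      (∀ g, g ∉ shortArrows Q (Γ ⧸ H₀) R → f g = 0) ∧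
      ∀ (x : URSGroupoid Q H₀) (δ : Γ) (p : Γ ⧸ H), x.Matches (2 * R + 1 + wordLength Q δ) p →
        f (arrowMk x δ) = ρ p (δ • p) := by
  classical
  choose v hv using fun x : URSGroupoid Q H₀ =>
    x.exists_matches_vertex Q hZ hH hH₀ (2 * R + 1)
  have hloc' : ∀ (x : URSGroupoid Q H₀) (p p' : Γ ⧸ H), x.Matches (2 * R + 1) p →
      x.Matches (2 * R + 1) p' → ∀ γ : Γ, wordLength Q γ ≤ R → ρ p (γ • p) = ρ p' (γ • p') := by
    intro x p p' hp hp' γ hγ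
    obtain ⟨θ⟩ := (hp.ballsAgree hp').rootLabelIso
    rw [← hloc p p' θ ⟨_, smul_mem_schreierBall hγ p⟩, θ.apply_smul hγ]
  let f : ArrowSpace (URSGroupoid Q H₀) → ℂ := fun g =>
    if h : g ∈ shortArrows Q (Γ ⧸ H₀) R then ρ (v g.rng) (h.choose • v g.rng) else 0
  have hf0 : ∀ g, g ∉ shortArrows Q (Γ ⧸ H₀) R → f g = 0 := fun g hg => dif_neg hg
  have hf : ∀ (x : URSGroupoid Q H₀) (γ : Γ) (p : Γ ⧸ H), wordLength Q γ ≤ R →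
      x.Matches (2 * R + 1) p → f (arrowMk x γ) = ρ p (γ • p) := by
    intro x γ p hγ hp
    have h : arrowMk x γ ∈ shortArrows Q (Γ ⧸ H₀) R := arrowMk_mem_shortArrows x hγ
    have h1 : f (arrowMk x γ) = ρ (v x) (h.choose • v x) := dif_pos h
    have h2 := h.choose_spec.1
    rw [h1, (hv x h.choose γ (by omega)).1 (arrowMk_eq_iff.1 h.choose_spec.2)]
    exact hloc' x _ p (hv x) hp γ hγ
  have hcont : Continuous f := by
    refine continuous_of_component (2 * R + 1) fun g h hgh => ?_
    by_cases hg : g ∈ shortArrows Q (Γ ⧸ H₀) R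
    · obtain ⟨γ, hγ, hg⟩ := hg
      rw [← hg] at hgh ⊢
      obtain ⟨hh, r, hr, hr'⟩ := eq_arrowMk_of_component_eq (by omega) hgh
      have h1 := hr'.matches.trans (hr.matches.ballsAgree (hv g.rng))
      rw [hh, hf _ γ _ hγ (hv g.rng), hf _ γ _ hγ h1]
    · rw [hf0 g hg, hf0 h fun hh => hg (mem_shortArrows_of_component_eq (by omega) hgh.symm hh)]
  refine ⟨⟨⟨f, hcont⟩, hasCompactSupport_of_shortArrows hf0⟩, hf0, fun x δ p hp => ?_⟩
  change f (arrowMk x δ) = _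
  by_cases h : arrowMk x δ ∈ shortArrows Q (Γ ⧸ H₀) R
  · obtain ⟨γ, hγ, hg⟩ := h
    have hg : arrowMk x γ = arrowMk x δ := hg
    rw [← hg, hf x γ p hγ (hp.mono (by omega)), (hp γ δ (by omega)).1 (arrowMk_eq_iff.1 hg)]
  · rw [hf0 _ h, hsupp]
    intro hδ
    obtain ⟨γ, hγ, hg⟩ := mem_schreierBall_iff.1 hδ
    exact h ⟨γ, hγ, arrowMk_eq_iff.2 ((hp γ δ (by omega)).2 hg)⟩

theorem LocalPropertyA.isTopologicallyAmenable {Z : Set (Subgroup Γ)} (hZ : IsURS Z)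
    {H H₀ : Subgroup Γ} (hH : H ∈ Z) (hH₀ : H₀ ∈ Z) (hA : LocalPropertyA Q H) :
    IsTopologicallyAmenable (URSGroupoid Q H₀) := by
  obtain ⟨ρ, hloc, hnorm, hdist⟩ := hA
  choose R hRpos hsupp hiso using fun n : ℕ => hloc (n + 1) (by omega)
  choose f hf0 hf using fun n : ℕ =>
    exists_function_of_local_vectors hZ hH hH₀ (ρ (n + 1)) (hsupp n) (hiso n)
  have hball : ∀ n (p z : Γ ⧸ H), ρ (n + 1) p z ≠ 0 → z ∈ schreierBall Q (R n) p :=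
    fun n p z hz => not_imp_comm.1 (hsupp n p z) hz
  -- The scale `3 R + 1` leaves room for the group elements of length at most `R` that are summed
  -- over, and passing from `x` to `δ x` costs `2 l(δ)`.
  refine ⟨ULift ℕ, inferInstance, inferInstance, inferInstance, fun i => f i.down,
    ⟨1, fun i x => ?_⟩, fun K hK => ?_⟩
  · obtain ⟨p, hp⟩ := x.exists_matches_vertex Q hZ hH hH₀ (3 * R i.down + 1)
    rw [tsum_fiber_eq (R := R i.down) (G := fun z => ‖ρ (i.down + 1) p z‖ ^ 2) hp (by omega)
      (fun h hh => exists_fiberMk_eq_of_ne_zero (hf0 i.down) fun h0 => hh (by simp [h0]))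
      (fun z hz => hball i.down p z fun h0 => hz (by simp [h0])) (fun γ hγ => ?_),
      ← lp_two_norm_sq, hnorm _ (by omega) p, one_pow]
    exact congrArg (fun s : ℂ => ‖s‖ ^ 2) (hf i.down x γ p (hp.mono (by omega)))
  · obtain ⟨L, hL⟩ := exists_subset_shortArrows hK
    rw [Metric.tendstoUniformlyOn_iff]
    intro ε hε
    obtain ⟨m, hm⟩ := exists_nat_one_div_lt hε
    filter_upwards [Filter.eventually_ge_atTop (ULift.up (max L m))] with i hi g hg
    have hi : max L m ≤ i.down := hi
    obtain ⟨δ, hδ, hgδ⟩ := hL hg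
    obtain ⟨p, hp⟩ := g.rng.exists_matches_vertex Q hZ hH hH₀ (3 * R i.down + 1 + 2 * L)
    rw [← hgδ, convStar_eq_inner (a := ρ (i.down + 1) p) (b := ρ (i.down + 1) (δ • p)) (hf0 i.down)
      (hp.smul (N := 3 * R i.down + 1) δ (by omega)) (by omega) (hball i.down _)
      (fun γ hγ => ?_) (fun γ hγ => ?_), dist_eq_norm]
    · have h1 : (schreierGraph Q (Γ ⧸ H)).edist p (δ • p) ≤ (i.down + 1 : ℕ) :=
        smul_mem_schreierBall (hδ.trans (by omega)) p
      calc _ ≤ ‖ρ (i.down + 1) p - ρ (i.down + 1) (δ • p)‖ :=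
            norm_one_sub_inner_le (hnorm _ (by omega) p)
        _ ≤ 1 / ((i.down + 1 : ℕ) : ℝ) := hdist _ (by omega) p _ h1
        _ ≤ 1 / ((m : ℝ) + 1) := by
            refine one_div_le_one_div_of_le (by positivity) ?_
            exact_mod_cast (by omega : m + 1 ≤ i.down + 1)
        _ < ε := hm
    · have h1 := wordLength_mul Q γ δ
      rw [hf i.down g.rng (γ * δ) p (hp.mono (by omega)), mul_smul]
    · exact hf i.down _ γ _ (hp.smul δ (by omega))

end Vectors

section Converse

variable {Γ : Type u} [Group Γ] {Q : GeneratingSystem Γ}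
variable {Y : Type u} [MulAction Γ Y] {H : Subgroup Γ}

/-! ### From functions on the groupoid to vectors on the Schreier graph -/

/-- The restriction of `F` to the fibre at a unit that looks like `p` at all scales, as a vector
on the Schreier graph. -/
theorem exists_fiberVector {F : ArrowSpace (UnitSpace Q Y) → ℂ} {R : ℕ}
    (hF : ∀ g, g ∉ shortArrows Q Y R → F g = 0) {x : UnitSpace Q Y} {p : Γ ⧸ H}
    (hx : ∀ M, x.Matches M p) :
    ∃ ξ : lp (fun _ : Γ ⧸ H => ℂ) 2, ∀ γ : Γ, ξ (γ • p) = F (arrowMk x γ) := by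
  choose t ht using fun z : Γ ⧸ H => MulAction.exists_smul_eq Γ p z
  have hval : ∀ γ : Γ, F (arrowMk x (t (γ • p))) = F (arrowMk x γ) := fun γ =>
    congrArg F (arrowMk_eq_iff.2 ((hx _ _ _ le_rfl).2 (ht (γ • p))))
  have hmem : Memℓp (E := fun _ : Γ ⧸ H => ℂ) (fun z => F (arrowMk x (t z))) 2 := by
    refine memℓp_gen (summable_of_hasFiniteSupport ?_)
    refine ((finite_wordLength_le Q R).image fun γ => γ • p).subset fun z hz => ?_
    have h1 : F (arrowMk x (t z)) ≠ 0 := fun h0 => hz (by simp [h0])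
    obtain ⟨γ, hγ, hg⟩ := not_imp_comm.1 (hF _) h1
    exact ⟨γ, hγ, ((hx _ _ _ le_rfl).1 (arrowMk_eq_iff.1 hg)).trans (ht z)⟩
  exact ⟨⟨_, hmem⟩, hval⟩

variable {F : ArrowSpace (UnitSpace Q Y) → ℂ} {R : ℕ} {x : UnitSpace Q Y} {p : Γ ⧸ H}
  {ξ : lp (fun _ : Γ ⧸ H => ℂ) 2}

theorem mem_schreierBall_of_fiberVector_ne_zero (hF : ∀ g, g ∉ shortArrows Q Y R → F g = 0)
    (hx : ∀ M, x.Matches M p) (hξ : ∀ γ : Γ, ξ (γ • p) = F (arrowMk x γ)) (z : Γ ⧸ H)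
    (hz : ξ z ≠ 0) : z ∈ schreierBall Q R p := by
  obtain ⟨γ, rfl⟩ := MulAction.exists_smul_eq Γ p z
  rw [hξ] at hz
  obtain ⟨γ', hγ', hg⟩ := not_imp_comm.1 (hF _) hz
  exact mem_schreierBall_iff.2 ⟨γ', hγ', (hx _ _ _ le_rfl).1 (arrowMk_eq_iff.1 hg)⟩

/-- The norm of a vector supported in a ball is invariant under isomorphisms of the ball. -/
theorem norm_eq_of_rootLabelIso {X : Type u} [MulAction Γ X] {M : ℕ} {p p' : X}
    (θ : RootLabelIso Q M p p') {a b : lp (fun _ : X => ℂ) 2}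
    (ha : ∀ z, a z ≠ 0 → z ∈ schreierBall Q M p) (hb : ∀ z, b z ≠ 0 → z ∈ schreierBall Q M p')
    (hab : ∀ u : schreierBall Q M p, b (θ.toEquiv u) = a u) : ‖a‖ = ‖b‖ := by
  refine (sq_eq_sq₀ (norm_nonneg _) (norm_nonneg _)).1 ?_
  rw [lp_two_norm_sq, lp_two_norm_sq,
    ← tsum_subtype_eq_of_support_subset (s := schreierBall Q M p)
      fun z hz => ha z fun h0 => hz (by simp [h0]),
    ← tsum_subtype_eq_of_support_subset (s := schreierBall Q M p')
      fun z hz => hb z fun h0 => hz (by simp [h0]), ← θ.toEquiv.tsum_eq]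
  simp only [hab]

/-- A function that depends on the `N`-component only induces vectors that are determined by the
isomorphism type of the `(2N + 1)`-ball. -/
theorem fiberVector_local {N : ℕ}
    (hFN : ∀ g h, arrowComponent N g = arrowComponent N h → F g = F h)
    (hF : ∀ g, g ∉ shortArrows Q Y N → F g = 0) {x' : UnitSpace Q Y} {p' : Γ ⧸ H}
    {ξ' : lp (fun _ : Γ ⧸ H => ℂ) 2} (hx : ∀ M, x.Matches M p) (hx' : ∀ M, x'.Matches M p')
    (hξ : ∀ γ : Γ, ξ (γ • p) = F (arrowMk x γ)) (hξ' : ∀ γ : Γ, ξ' (γ • p') = F (arrowMk x' γ))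
    (θ : RootLabelIso Q (2 * N + 1) p p') (u : schreierBall Q (2 * N + 1) p) :
    ξ' (θ.toEquiv u) = ξ u := by
  obtain ⟨u, hu⟩ := u
  obtain ⟨γ, hγ, rfl⟩ := mem_schreierBall_iff.1 hu
  rw [θ.apply_smul hγ]
  by_cases h : ∃ γ' : Γ, wordLength Q γ' ≤ N ∧ γ' • p = γ • p
  · obtain ⟨γ', hγ', h⟩ := h
    rw [← (θ.smul_eq_iff (by omega) hγ).1 h]
    change ξ' (γ' • p') = ξ (γ • p)
    rw [← h, hξ, hξ']
    exact hFN _ _ (arrowComponent_arrowMk_eq le_rfl hγ'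
      (UnitSpace.coord_eq_of_matches (hx _) (hx' _) θ.ballsAgree)).symm
  · have h1 : γ • p ∉ schreierBall Q N p := fun hm => h (mem_schreierBall_iff.1 hm)
    have h2 : γ • p' ∉ schreierBall Q N p' := fun hm => by
      obtain ⟨γ', hγ', h'⟩ := mem_schreierBall_iff.1 hm
      exact h ⟨γ', hγ', (θ.smul_eq_iff (by omega) hγ).2 h'⟩
    rw [not_imp_comm.1 (mem_schreierBall_of_fiberVector_ne_zero hF hx' hξ' _) h2]
    exact (not_imp_comm.1 (mem_schreierBall_of_fiberVector_ne_zero hF hx hξ _) h1).symm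

/-- One step of local property A, from a function on the groupoid for which `f * f^*` is close to
`1` on the arrows of length at most `n`. -/
theorem exists_local_vectors {Z : Set (Subgroup Γ)} (hZ : IsURS Z) {H₀ : Subgroup Γ}
    (hH : H ∈ Z) (hH₀ : H₀ ∈ Z) {n : ℕ} (hn : 1 ≤ n)
    (f : CompactlySupportedContinuousMap (ArrowSpace (URSGroupoid Q H₀)) ℂ)
    (hf : ∀ g ∈ shortArrows Q (Γ ⧸ H₀) n, ‖1 - convStar f g‖ ≤ (1 / (32 * n : ℝ)) ^ 2) :
    ∃ ρ : Γ ⧸ H → lp (fun _ : Γ ⧸ H => ℂ) 2,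
      (∃ R : ℕ, 0 < R ∧
        (∀ x y : Γ ⧸ H, y ∉ schreierBall Q R x → ρ x y = 0) ∧
        ∀ (x y : Γ ⧸ H) (θ : RootLabelIso Q R x y) (z : schreierBall Q R x),
          ρ y (θ.toEquiv z) = ρ x z) ∧
      (∀ x, ‖ρ x‖ = 1) ∧
      ∀ x y : Γ ⧸ H, (schreierGraph Q (Γ ⧸ H)).edist x y ≤ n → ‖ρ x - ρ y‖ ≤ 1 / (n : ℝ) := by
  classical
  have hn' : (1 : ℝ) ≤ n := by exact_mod_cast hn
  obtain ⟨R, hR⟩ := exists_subset_shortArrows f.hasCompactSupport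
  have hf0 : ∀ g, g ∉ shortArrows Q (Γ ⧸ H₀) R → f g = 0 := fun g hg =>
    image_eq_zero_of_notMem_tsupport fun h => hg (hR h)
  let B : Finset Γ := (finite_wordLength_le Q R).toFinset
  -- All vectors are supported on at most `B.card` vertices, so that this `δ` gives an error of at
  -- most `η` in norm.
  set η : ℝ := 1 / (32 * n) with hη
  have hη0 : 0 < η := by positivity
  have hη1 : η ≤ 1 / 32 := by
    rw [hη]
    exact one_div_le_one_div_of_le (by norm_num) (by linarith)
  set δ : ℝ := η / (B.card + 1) with hδ
  have hδ0 : 0 < δ := by positivity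
  have hδη : B.card * δ ^ 2 ≤ η ^ 2 := by
    have h1 : (B.card + 1) * δ = η := by rw [hδ]; field_simp
    rw [← h1]
    have h2 : (0 : ℝ) ≤ B.card := by positivity
    nlinarith [sq_nonneg δ, mul_nonneg h2 (sq_nonneg δ), mul_nonneg (sq_nonneg (B.card : ℝ))
      (sq_nonneg δ)]
  obtain ⟨N, f', hRN, hfN, hf0', hff'⟩ := exists_component_approx f.continuous hf0 hδ0
  choose x hx using fun p : Γ ⧸ H => UnitSpace.exists_matches_unit Q hZ hH hH₀ p
  have hx_smul : ∀ (γ : Γ) p, x (γ • p) = γ • x p := fun γ p =>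
    UnitSpace.eq_of_matches (hx _) fun M => (hx p _).smul γ le_rfl
  choose ξ hξ using fun p => exists_fiberVector hf0 (hx p)
  choose ξ' hξ' using fun p => exists_fiberVector hf0' (hx p)
  have hξB := fun p => mem_schreierBall_of_fiberVector_ne_zero hf0 (hx p) (hξ p)
  have hξB' := fun p => mem_schreierBall_of_fiberVector_ne_zero hf0' (hx p) (hξ' p)
  have hclose : ∀ p, ‖ξ p - ξ' p‖ ≤ η := fun p => by
    refine abs_le_of_sq_le_sq' ?_ hη0.le |>.2
    refine (lp_two_norm_sq_le _ (B.image fun γ => γ • p) (c := δ) (fun z hz => ?_)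
      fun z => ?_).trans (le_trans ?_ hδη)
    · have hz' : z ∉ schreierBall Q R p := fun h => by
        obtain ⟨γ, hγ, h⟩ := mem_schreierBall_iff.1 h
        exact hz (Finset.mem_image.2 ⟨γ, (finite_wordLength_le Q R).mem_toFinset.2 hγ, h⟩)
      rw [lp.coeFn_sub, Pi.sub_apply, not_imp_comm.1 (hξB p z) hz',
        not_imp_comm.1 (hξB' p z) hz', sub_zero]
    · obtain ⟨γ, rfl⟩ := MulAction.exists_smul_eq Γ p z
      rw [lp.coeFn_sub, Pi.sub_apply, hξ, hξ']
      exact hff' _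
    · exact mul_le_mul_of_nonneg_right (by exact_mod_cast Finset.card_image_le) (sq_nonneg δ)
  have hinner : ∀ p γ, wordLength Q γ ≤ n → ‖1 - inner ℂ (ξ (γ • p)) (ξ p)‖ ≤ η ^ 2 := by
    intro p γ hγ
    rw [← convStar_eq_inner (F := f) (R := R) (x := x p) (δ := γ) (M := 2 * R) (q := γ • p) hf0
      (by rw [← hx_smul]; exact hx _ _) le_rfl (hξB _) (fun γ' _ => by rw [← mul_smul, hξ])
      (fun γ' _ => by rw [hξ, hx_smul])]
    exact hf _ (arrowMk_mem_shortArrows _ hγ)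
  have hinner1 : ∀ p, ‖1 - inner ℂ (ξ p) (ξ p)‖ ≤ η ^ 2 := fun p => by
    simpa using hinner p 1 (by simp [wordLength_one])
  have hdist : ∀ p γ, wordLength Q γ ≤ n → ‖ξ p - ξ (γ • p)‖ ≤ 2 * η := fun p γ hγ => by
    refine abs_le_of_sq_le_sq' ?_ (by positivity) |>.2
    refine (norm_sub_sq_le_of_inner (hinner1 p) (hinner1 _) (hinner p γ hγ)).trans (le_of_eq ?_)
    ring
  -- The vectors `ξ' p` at distance at most `n` differ by `2 η + 2 η`, and dividing by norms at least
  -- `1 / 2` costs a factor `4`, so that the final estimate is `16 η ≤ 1 / n`.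
  have hnorm : ∀ p, 1 / 2 ≤ ‖ξ' p‖ := fun p => by
    have h1 := abs_le.1 ((Complex.abs_re_le_norm _).trans (hinner1 p))
    rw [inner_self_eq_norm_sq_to_K] at h1
    have h2 : (1 - ((‖ξ p‖ : ℂ)) ^ 2).re = 1 - ‖ξ p‖ ^ 2 := by
      rw [Complex.sub_re, Complex.one_re, ← Complex.ofReal_pow, Complex.ofReal_re]
    have h3 : 1 - ‖ξ p‖ ^ 2 ≤ η ^ 2 := h2 ▸ h1.2
    have h4 := (norm_sub_norm_le (ξ p) (ξ' p)).trans (hclose p)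
    nlinarith [norm_nonneg (ξ p)]
  have hne : ∀ p, ξ' p ≠ 0 := fun p h0 => by
    have := hnorm p
    rw [h0, norm_zero] at this
    norm_num at this
  have hB : ∀ p z, ξ' p z ≠ 0 → z ∈ schreierBall Q (2 * N + 1) p := fun p z hz =>
    schreierBall_mono (by omega) p (hξB' p z hz)
  have hval : ∀ p z, (‖ξ' p‖⁻¹ • ξ' p) z = ‖ξ' p‖⁻¹ • ξ' p z := fun p z => rfl
  refine ⟨fun p => ‖ξ' p‖⁻¹ • ξ' p, ⟨2 * N + 1, by omega, fun p z hz => ?_, fun p p' θ z => ?_⟩,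
    fun p => ?_, fun p p' hpp' => ?_⟩
  · rw [hval, not_imp_comm.1 (hB p z) hz, smul_zero]
  · have hloc := fiberVector_local hfN (fun g hg => hf0' g fun h => hg (shortArrows_mono hRN h))
      (hx p) (hx p') (hξ' p) (hξ' p') θ
    rw [hval, hval, hloc z, norm_eq_of_rootLabelIso θ (hB p) (hB p') hloc]
  · rw [norm_smul, norm_inv, norm_norm, inv_mul_cancel₀ (norm_ne_zero_iff.2 (hne p))]
  · obtain ⟨γ, hγ, rfl⟩ := mem_schreierBall_iff.1 (show p' ∈ schreierBall Q n p from hpp')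
    have h1 : ‖ξ' p - ξ' (γ • p)‖ ≤ 4 * η := by
      have h2 : ξ' p - ξ' (γ • p) =
          (ξ p - ξ (γ • p)) - (ξ p - ξ' p) + (ξ (γ • p) - ξ' (γ • p)) := by abel
      rw [h2]
      have h3 := norm_add_le ((ξ p - ξ (γ • p)) - (ξ p - ξ' p)) (ξ (γ • p) - ξ' (γ • p))
      have h4 := norm_sub_le (ξ p - ξ (γ • p)) (ξ p - ξ' p)
      linarith [hclose p, hclose (γ • p), hdist p γ hγ]
    refine (norm_normalize_sub_normalize_le (hne p) (hne _)).trans ?_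
    rw [div_le_iff₀ (norm_pos_iff.2 (hne p))]
    have h5 : η * 32 = 1 / n := by rw [hη]; field_simp
    nlinarith [hnorm p]

theorem localPropertyA_of_isTopologicallyAmenable {Z : Set (Subgroup Γ)} (hZ : IsURS Z)
    {H₀ : Subgroup Γ} (hH : H ∈ Z) (hH₀ : H₀ ∈ Z)
    (hA : IsTopologicallyAmenable (URSGroupoid Q H₀)) : LocalPropertyA Q H := by
  obtain ⟨ι, _, _, _, f, -, hf⟩ := hA
  have happrox : ∀ n : ℕ, 1 ≤ n → ∃ i, ∀ g ∈ shortArrows Q (Γ ⧸ H₀) n,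
      ‖1 - convStar (f i) g‖ ≤ (1 / (32 * n : ℝ)) ^ 2 := fun n hn => by
    have hn' : (0 : ℝ) < n := by exact_mod_cast hn
    obtain ⟨i, hi⟩ := ((Metric.tendstoUniformlyOn_iff.1
      (hf _ (isCompact_shortArrows n))) ((1 / (32 * n : ℝ)) ^ 2) (by positivity)).exists
    refine ⟨i, fun g hg => ?_⟩
    rw [← dist_eq_norm]
    exact (hi g hg).le
  choose i hi using happrox
  choose ρ hρ using fun n hn => exists_local_vectors hZ hH hH₀ hn (f (i n hn)) (hi n hn)
  refine ⟨fun n => if hn : 1 ≤ n then ρ n hn else 0, fun n hn => ?_, fun n hn => ?_,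
    fun n hn => ?_⟩ <;> simp only [dif_pos hn]
  exacts [(hρ n hn).1, (hρ n hn).2.1, (hρ n hn).2.2]

end Converse

theorem theorem5p3 {Γ : Type u} [Group Γ] (Q : GeneratingSystem Γ)
    (Z : Set (Subgroup Γ)) (hZ : IsURS Z)
    (H₀ : Subgroup Γ) (hH₀ : H₀ ∈ Z) (H : Subgroup Γ) (hH : H ∈ Z) :
    LocalPropertyA Q H ↔ IsTopologicallyAmenable (URSGroupoid Q H₀) :=
  ⟨fun h => h.isTopologicallyAmenable hZ hH hH₀, localPropertyA_of_isTopologicallyAmenable hZ hH hH₀⟩
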